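/- Let $N\ge 1$ be an integer. For an $L^2$ function, derivatives are understood in the weak sense, and $H^1=\{u\in L^2: \nabla u\in L^2\}$. Let $\mathcal{R}_N$ be the class of all $\rho:\mathbb{R}^3\to\mathbb{R}$ with $\rho\ge 0$ (almost everywhere), $\sqrt{\rho}\in H^1(\mathbb{R}^3)$ and $\int_{\mathbb{R}^3}\rho\,dx=N$. Let $\mathcal{A}_N$ be the set of all $\Psi\in L^2((\mathbb{R}^3\times\mathbb{Z}_2)^N;\mathbb{C})$ with $\nabla\Psi\in L^2$ (gradient with respect to the positions) and $\|\Psi\|_{L^2}=1$ that are antisymmetric, $\Psi(z_{\sigma(1)},\dots,z_{\sigma(N)})=\operatorname{sgn}(\sigma)\Psi(z_1,\dots,z_N)$ for all permutations $\sigma$, where $z_i=(x_i,s_i)$ are space-spin coordinates. Let $\mathcal{B}_N$ be the set of all $\Phi\in L^2(\mathbb{R}^{3N};\mathbb{C})$ with $\nabla\Phi\in L^2$ and $\|\Phi\|_{L^2}=1$ that are symmetric, $\Phi(x_{\sigma(1)},\dots,x_{\sigma(N)})=\Phi(x_1,\dots,x_N)$ for all $\sigma$. For $\Psi\in\mathcal{A}_N$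 put $$T[\Psi]=\int_{\mathbb{R}^{3N}}\sum_{s_1,\dots,s_N\in\mathbb{Z}_2}\sum_{i=1}^N|\nabla_{x_i}\Psi|^2\,dx_1\cdots dx_N,\qquad V_{ee}[\Psi]=\int_{\mathbb{R}^{3N}}\sum_{s_1,\dots,s_N\in\mathbb{Z}_2}\sum_{1\le i<j\le N}\frac{|\Psi|^2}{|x_i-x_j|}\,dx_1\cdots dx_N,$$ and write $\Psi\mapsto\rho$ if $N\int_{\mathbb{R}^{3(N-1)}}\sum_{s_1,\dots,s_N\in\mathbb{Z}_2}|\Psi(x_1,s_1,\dots,x_N,s_N)|^2\,dx_2\cdots dx_N=\rho(x_1)$ for almost every $x_1\in\mathbb{R}^3$. For $\Phi\in\mathcal{B}_N$ the same notation is used without the spin variables and the sums over them. For $\alpha>0$ define $$F^{HK}_\alpha[\rho]=\inf_{\Psi\in\mathcal{A}_N,\ \Psi\mapsto\rho}\bigl\{\alpha T[\Psi]+V_{ee}[\Psi]\bigr\},\qquad F^{Bos}_\alpha[\rho]=\inf_{\Phi\in\mathcal{B}_N,\ \Phi\mapsto\rho}\bigl\{\alpha T[\Phi]+V_{ee}[\Phi]\bigr\}.$$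 Theorem. For every $\rho\in\mathcal{R}_N$, the limits of $F^{HK}_\alpha[\rho]$ and $F^{Bos}_\alpha[\rho]$ as $\alpha\to 0^+$ exist, are finite, and $$\lim_{\alpha\to 0}F^{HK}_\alpha[\rho]=\lim_{\alpha\to 0}F^{Bos}_\alpha[\rho].$$ -/

import Mathlib

open MeasureTheory Filter Topology
open scoped ENNReal NNReal ContDiff

noncomputable section

section Sobolev

variable {E F : Type*} [NormedAddCommGroup E] [NormedSpace ℝ E] [MeasureSpace E]
  [NormedAddCommGroup F] [NormedSpace ℝ F]

/-- `v` is the weak (distributional) derivative of `u` in the direction `e`: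
`∫ (∂ₑ φ) u = - ∫ φ v` for all smooth compactly supported real test functions `φ`. It is used only
for `u`, `v` in `L²`, where both integrals converge. -/
def HasWeakDeriv (u v : E → F) (e : E) : Prop :=
  ∀ φ : E → ℝ, ContDiff ℝ ∞ φ → HasCompactSupport φ →
    ∫ x, (fderiv ℝ φ x e) • u x = - ∫ x, φ x • v x

/-- The Sobolev space `H¹`: `u ∈ L²`, and every directional weak derivative of `u` is in `L²`. -/
def MemH1 (u : E → F) : Prop :=
  MemLp u 2 volume ∧ ∀ e : E, ∃ v : E → F, MemLp v 2 volume ∧ HasWeakDeriv u v e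

open Classical in
/-- The weak derivative of `u` in the direction `e` (unique up to null sets), with the value `0` if
`u` has no weak derivative in `L²` in that direction. -/
def weakDeriv (u : E → F) (e : E) : E → F :=
  if h : ∃ v : E → F, MemLp v 2 volume ∧ HasWeakDeriv u v e then h.choose else 0

end Sobolev

/-- Physical space `ℝ³` with the Euclidean norm. -/
abbrev Space : Type := EuclideanSpace ℝ (Fin 3)

/-- Configurations `(x₁, …, x_N)` of `N` particles: `ℝ³ᴺ`, with its Lebesgue measure. -/
abbrev Config (N : ℕ) : Type := Fin N → Space

/-- The unit vector of `ℝ³ᴺ` that belongs to the `k`-th coordinate of the `i`-th particle. -/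
def coordVec (N : ℕ) (i : Fin N) (k : Fin 3) : Config N :=
  Pi.single i (EuclideanSpace.single k (1 : ℝ))

/-- `∫ ∑ᵢ |∇_{xᵢ} Φ|² dx₁ … dx_N` for a spinless function `Φ`. -/
def kineticEnergy {N : ℕ} (Φ : Config N → ℂ) : ℝ≥0∞ :=
  ∫⁻ x, ∑ i : Fin N, ∑ k : Fin 3, ‖weakDeriv Φ (coordVec N i k) x‖ₑ ^ 2

/-- `∫ ∑_{i<j} |xᵢ - xⱼ|⁻¹ |Φ|² dx₁ … dx_N` for a spinless function `Φ`. -/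
def interactionEnergy {N : ℕ} (Φ : Config N → ℂ) : ℝ≥0∞ :=
  ∫⁻ x, ∑ i : Fin N, ∑ j ∈ Finset.Ioi i, ‖x i - x j‖ₑ⁻¹ * ‖Φ x‖ₑ ^ 2

/-- The one-body density `x₁ ↦ N ∫ |Φ(x₁, …, x_N)|² dx₂ … dx_N` of a spinless function `Φ` of
`N = n + 1` particles. -/
def oneBodyDensity {n : ℕ} (Φ : Config (n + 1) → ℂ) (x₁ : Space) : ℝ≥0∞ :=
  ((n + 1 : ℕ) : ℝ≥0∞) * ∫⁻ y : Config n, ‖Φ (Fin.cons x₁ y)‖ₑ ^ 2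

/-- The function `x ↦ Ψ(x₁, s₁, …, x_N, s_N)` for fixed spins `s₁, …, s_N`. -/
def spinComponent {N : ℕ} (Ψ : (Fin N → Space × ZMod 2) → ℂ) (s : Fin N → ZMod 2) :
    Config N → ℂ :=
  fun x => Ψ fun i => (x i, s i)

/-- The class `𝒜_N` of fermionic wavefunctions: `Ψ ∈ L²((ℝ³ × ℤ₂)ᴺ; ℂ)`, `∇Ψ ∈ L²`, `Ψ`
antisymmetric (up to null sets) in the space-spin coordinates, `‖Ψ‖ = 1`. -/
structure IsFermionic {N : ℕ} (Ψ : (Fin N → Space × ZMod 2) → ℂ) : Prop where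
  memH1 : ∀ s, MemH1 (spinComponent Ψ s)
  antisymm : ∀ (σ : Equiv.Perm (Fin N)) (s : Fin N → ZMod 2), ∀ᵐ x : Config N,
    Ψ (fun i => (x (σ i), s (σ i))) = ((Equiv.Perm.sign σ : ℤ) : ℂ) * Ψ fun i => (x i, s i)
  norm_eq_one : ∑ s : Fin N → ZMod 2, ∫⁻ x, ‖spinComponent Ψ s x‖ₑ ^ 2 = 1

/-- The class `ℬ_N` of bosonic wavefunctions: `Φ ∈ L²(ℝ³ᴺ; ℂ)`, `∇Φ ∈ L²`, `Φ` symmetric (up to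
null sets), `‖Φ‖ = 1`. -/
structure IsBosonic {N : ℕ} (Φ : Config N → ℂ) : Prop where
  memH1 : MemH1 Φ
  symm : ∀ σ : Equiv.Perm (Fin N), ∀ᵐ x : Config N, Φ (fun i => x (σ i)) = Φ x
  norm_eq_one : ∫⁻ x, ‖Φ x‖ₑ ^ 2 = 1

/-- `Ψ ↦ ρ` for a wavefunction with spin: the one-body density of `Ψ` is `ρ`. -/
def FermionicRepresents {n : ℕ} (Ψ : (Fin (n + 1) → Space × ZMod 2) → ℂ) (ρ : Space → ℝ) : Prop :=
  ∀ᵐ x : Space, ∑ s : Fin (n + 1) → ZMod 2, oneBodyDensity (spinComponent Ψ s) x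
    = ENNReal.ofReal (ρ x)

/-- `Φ ↦ ρ` for a spinless wavefunction: the one-body density of `Φ` is `ρ`. -/
def BosonicRepresents {n : ℕ} (Φ : Config (n + 1) → ℂ) (ρ : Space → ℝ) : Prop :=
  ∀ᵐ x : Space, oneBodyDensity Φ x = ENNReal.ofReal (ρ x)

/-- The Hohenberg-Kohn functional `F^{HK}_α[ρ]` for `N = n + 1` electrons: the infimum of
`α T[Ψ] + V_ee[Ψ]` over `Ψ ∈ 𝒜_N` with `Ψ ↦ ρ`. -/
def FHK (n : ℕ) (α : ℝ) (ρ : Space → ℝ) : ℝ≥0∞ :=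
  ⨅ (Ψ : (Fin (n + 1) → Space × ZMod 2) → ℂ) (_ : IsFermionic Ψ) (_ : FermionicRepresents Ψ ρ),
    ENNReal.ofReal α * ∑ s : Fin (n + 1) → ZMod 2, kineticEnergy (spinComponent Ψ s)
      + ∑ s : Fin (n + 1) → ZMod 2, interactionEnergy (spinComponent Ψ s)

/-- The bosonic functional `F^{Bos}_α[ρ]` for `N = n + 1` particles: the infimum of
`α T[Φ] + V_ee[Φ]` over `Φ ∈ ℬ_N` with `Φ ↦ ρ`. -/
def FBos (n : ℕ) (α : ℝ) (ρ : Space → ℝ) : ℝ≥0∞ :=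
  ⨅ (Φ : Config (n + 1) → ℂ) (_ : IsBosonic Φ) (_ : BosonicRepresents Φ ρ),
    ENNReal.ofReal α * kineticEnergy Φ + interactionEnergy Φ

/-- The class `ℛ_N` of one-body densities: `ρ ≥ 0`, `√ρ ∈ H¹(ℝ³)`, `∫ ρ = N`. -/
structure IsDensity (N : ℕ) (ρ : Space → ℝ) : Prop where
  nonneg : ∀ᵐ x : Space, 0 ≤ ρ x
  sqrt_memH1 : MemH1 fun x : Space => √(ρ x)
  integral_eq : ∫ x, ρ x = N

end

set_option linter.unusedSectionVars false

/-! Since `α T ≥ 0` and every admissible function has finite kinetic energy, `α T + V_ee` has as its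
infimum, in the limit `α → 0`, the infimum of `V_ee` alone over the same class
(`tendsto_iInf_mul_add`). It remains to see that the fermionic and bosonic infima of `V_ee` agree
and are finite.

From fermions to bosons, replace `Ψ` by the square root of `∑ₛ |Ψ(·, s)|²`: density and interaction
depend only on this modulus, which is symmetric and in `H¹`.

From bosons to fermions, let `P` be an antisymmetric Lipschitz cutoff built from the first
coordinates of the particles, equal to `±1` away from coincidences of those coordinates, and split
`|Φ|² = |sin(πP/2) Φ|² + |cos(πP/2) Φ|²`. The sine part is antisymmetric and costs no more
interaction than `Φ`. The cosine part has small mass but the wrong symmetry; only its density `w²`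
is kept, and an antisymmetric function of density `w²` takes its place. The two pieces live on the
spin configurations all-`0` and all-`1`, so densities and energies add without cross terms.

The replacement (`exists_antisymm_of_sqrtDensity`) is `∏ w(xⱼ) · ∏_{i<j} sin π(G(xⱼ) - G(xᵢ))` up to
normalization, where `G` is the distribution function of one coordinate under the normalized `w²`.
In the variables `G(xᵢ)` the square of the sine product is translation invariant on the circle, so
integrating out all particles but one gives a constant and the density is exactly `w²`. As `G` is
Lipschitz, the sines cancel the Coulomb singularity, and the energy is at most a constant times `C
‖w‖`, where `C` bounds the derivative of `w` in one direction. That direction is taken transverse to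
the cutoff, so `C` stays bounded as the cutoff sharpens while `‖w‖ → 0`. Applied to `√ρ`, the same
construction shows that the infimum is finite. -/

noncomputable section

/-! ### Characterization of `H¹` by bounded difference quotients. -/

section DifferenceQuotients

variable {E F : Type*} [NormedAddCommGroup E] [NormedSpace ℝ E] [MeasureSpace E]

/-- The `L²` difference quotients of `u` in the direction `e` are bounded by `C`. -/
def HasDiffBound [NormedAddCommGroup F] (u : E → F) (e : E) (C : ℝ≥0) : Prop :=
  ∀ t : ℝ, eLpNorm (fun x => u (x + t • e) - u x) 2 volume ≤ C * ‖t‖ₑ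

variable [NormedAddCommGroup F] [InnerProductSpace ℝ F] [FiniteDimensional ℝ F]
  [FiniteDimensional ℝ E] [BorelSpace E] [(volume : Measure E).IsAddHaarMeasure]

/-- The integral is the convolution of `u` with the reflected `φ`, evaluated at `-r • e`, so it is
differentiable although `u` is only locally integrable. -/
theorem hasDerivAt_integral_inner_translate {u φ : E → F} (hu : LocallyIntegrable u volume)
    (hφ : ContDiff ℝ 1 φ) (hc : HasCompactSupport φ) (e : E) (s : ℝ) :
    HasDerivAt (fun r : ℝ => ∫ x, inner ℝ (φ (x + r • e)) (u x))
      (∫ x, inner ℝ (fderiv ℝ φ (x + s • e) e) (u x)) s := by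
  let L : F →L[ℝ] F →L[ℝ] ℝ := (innerₗ F).mkContinuous₂ 1 fun x y => by
    simpa using abs_real_inner_le_norm x y
  have hL : ∀ x y, L x y = inner ℝ y x := fun x y => by
    rw [real_inner_comm]; rfl
  let g : E → F := fun z => φ (-z)
  have hg : ContDiff ℝ 1 g := hφ.comp contDiff_neg
  have hgc : HasCompactSupport g := hc.comp_homeomorph (Homeomorph.neg E)
  have h := hgc.hasFDerivAt_convolution_right L hu hg (-(s • e))
  have hl : HasDerivAt (fun r : ℝ => -(r • e)) (-e) s := by
    have := ((hasDerivAt_id s).smul_const e).neg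
    rw [one_smul] at this
    exact this
  have h2 := h.comp_hasDerivAt s hl
  have hgd : ∀ z, fderiv ℝ g z (-e) = fderiv ℝ φ (-z) e := by
    intro z
    have : HasFDerivAt g ((fderiv ℝ φ (-z)).comp (-(ContinuousLinearMap.id ℝ E))) z :=
      ((hφ.differentiable one_ne_zero) (-z)).hasFDerivAt.comp z ((hasFDerivAt_id z).neg)
    rw [this.fderiv]; simp
  rw [convolution_precompR_apply L hu (hgc.fderiv ℝ) (hg.continuous_fderiv one_ne_zero)] at h2
  have e1 : (fun r : ℝ => ∫ x, inner ℝ (φ (x + r • e)) (u x))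
      = convolution u g L volume ∘ fun r : ℝ => -(r • e) := by
    ext r
    change _ = ∫ x, L (u x) (g (-(r • e) - x))
    refine integral_congr_ae (.of_forall fun x => ?_)
    simp only [hL, g]
    congr 2; abel
  have e2 : ∫ x, inner ℝ (fderiv ℝ φ (x + s • e) e) (u x)
      = convolution u (fun a => (fderiv ℝ g a) (-e)) L volume (-(s • e)) := by
    change _ = ∫ x, L (u x) (fderiv ℝ g (-(s • e) - x) (-e))
    refine integral_congr_ae (.of_forall fun x => ?_)
    simp only [hL, hgd]
    congr 4; abel
  rw [e1, e2]
  exact h2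

/-- Passes from scalar to vector-valued test functions by expanding in an orthonormal basis of `F`.
-/
theorem HasWeakDeriv.integral_inner {u v φ : E → F} {e : E} (h : HasWeakDeriv u v e)
    (hu : LocallyIntegrable u volume) (hv : LocallyIntegrable v volume)
    (hφ : ContDiff ℝ ∞ φ) (hc : HasCompactSupport φ) :
    ∫ x, inner ℝ (fderiv ℝ φ x e) (u x) = - ∫ x, inner ℝ (φ x) (v x) := by
  let b := stdOrthonormalBasis ℝ F
  have key : ∀ (c : F) , ∫ x, inner ℝ c (fderiv ℝ φ x e) * inner ℝ c (u x)
      = - ∫ x, inner ℝ c (φ x) * inner ℝ c (v x) := by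
    intro c
    have hd : ContDiff ℝ ∞ fun x => inner ℝ c (φ x) := contDiff_const.inner ℝ hφ
    have hdc : HasCompactSupport fun x => inner ℝ c (φ x) :=
      hc.comp_left (g := fun y => inner ℝ c y) (by simp)
    have h1 := h _ hd hdc
    have hfd : ∀ x, fderiv ℝ (fun x => inner ℝ c (φ x)) x e = inner ℝ c (fderiv ℝ φ x e) := by
      intro x
      rw [fderiv_inner_apply ℝ (by fun_prop) ((hφ.differentiable (by simp)) x)]
      simp
    simp only [hfd] at h1
    have hcd : Continuous fun x => inner ℝ c (fderiv ℝ φ x e) :=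
      continuous_const.inner ((hφ.continuous_fderiv (by simp)).clm_apply continuous_const)
    have hcdc : HasCompactSupport fun x => inner ℝ c (fderiv ℝ φ x e) :=
      (hc.fderiv_apply ℝ e).comp_left (g := fun y => inner ℝ c y) (by simp)
    have i1 := hu.integrable_smul_left_of_hasCompactSupport hcd hcdc
    have i2 := hv.integrable_smul_left_of_hasCompactSupport hd.continuous hdc
    have h2 := congrArg (fun z => inner ℝ c z) h1
    simp only [inner_neg_right] at h2
    rw [← _root_.integral_inner i1, ← _root_.integral_inner i2] at h2
    simpa [inner_smul_right] using h2
  have int : ∀ {ψ w : E → F} (_ : LocallyIntegrable w volume) (_ : Continuous ψ)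
      (_ : HasCompactSupport ψ) (c : F), Integrable fun x => inner ℝ c (ψ x) * inner ℝ c (w x) := by
    intro ψ w hw hψ hψc c
    have := (hw.integrable_smul_left_of_hasCompactSupport (continuous_const.inner hψ)
      (hψc.comp_left (g := fun y => inner ℝ c y) (by simp))).const_inner (𝕜 := ℝ) c
    simpa [inner_smul_right] using this
  have expand : ∀ {ψ w : E → F} (_ : LocallyIntegrable w volume) (_ : Continuous ψ)
      (_ : HasCompactSupport ψ), ∫ x, inner ℝ (ψ x) (w x)
        = ∑ i, ∫ x, inner ℝ (b i) (ψ x) * inner ℝ (b i) (w x) := by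
    intro ψ w hw hψ hψc
    rw [← integral_finsetSum _ fun i _ => int hw hψ hψc (b i)]
    congr 1; ext x
    rw [← b.sum_inner_mul_inner]
    exact Finset.sum_congr rfl fun i _ => by rw [real_inner_comm]
  rw [expand hu ((hφ.continuous_fderiv (by simp)).clm_apply continuous_const)
    (hc.fderiv_apply ℝ e), expand hv hφ.continuous hc,
    ← Finset.sum_neg_distrib]
  exact Finset.sum_congr rfl fun i _ => key (b i)

theorem MeasureTheory.MemLp.comp_add_smul {u : E → F} (hu : MemLp u 2 volume) (e : E) (t : ℝ) :
    MemLp (fun x => u (x + t • e)) 2 volume :=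
  hu.comp_measurePreserving (measurePreserving_add_right volume (t • e))

theorem eLpNorm_comp_add {u : E → F} (hu : AEStronglyMeasurable u volume) (y : E) :
    eLpNorm (fun x => u (x + y)) 2 volume = eLpNorm u 2 volume :=
  eLpNorm_comp_measurePreserving hu (measurePreserving_add_right volume y)

theorem abs_integral_inner_le {f g : E → F} (hf : MemLp f 2 volume) (hg : MemLp g 2 volume) :
    |∫ x, inner ℝ (f x) (g x)| ≤ (eLpNorm f 2 volume).toReal * (eLpNorm g 2 volume).toReal := by
  have := abs_real_inner_le_norm (hf.toLp f) (hg.toLp g)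
  rw [L2.inner_def, Lp.norm_toLp, Lp.norm_toLp] at this
  refine le_of_eq_of_le ?_ this
  congr 1
  refine integral_congr_ae ?_
  filter_upwards [hf.coeFn_toLp, hg.coeFn_toLp] with x h1 h2
  rw [h1, h2]

/-- By duality: paired with a test function `φ`, the translation moves onto `φ`; the resulting
function of the shift has derivative at most `‖φ‖ ‖v‖`, so the mean value inequality applies.
Density of test functions in `L²` finishes. -/
theorem HasWeakDeriv.hasDiffBound {u v : E → F} {e : E} (h : HasWeakDeriv u v e)
    (hu : MemLp u 2 volume) (hv : MemLp v 2 volume) :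
    HasDiffBound u e (eLpNorm v 2 volume).toNNReal := by
  intro t
  have hul := hu.locallyIntegrable one_le_two
  have hvl := hv.locallyIntegrable one_le_two
  set V := (eLpNorm v 2 volume).toReal
  have hG : MemLp (fun x => u (x + t • e) - u x) 2 volume := (hu.comp_add_smul e t).sub hu
  -- testing against smooth functions
  have test : ∀ φ : E → F, ContDiff ℝ ∞ φ → HasCompactSupport φ →
      |∫ x, inner ℝ (φ x) (u (x + t • e) - u x)| ≤ V * |t| * (eLpNorm φ 2 volume).toReal := by
    intro φ hφ hc
    have hφL : MemLp φ 2 volume := hφ.continuous.memLp_of_hasCompactSupport hc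
    have hder := hasDerivAt_integral_inner_translate hul (hφ.of_le (by simp)) hc e
    have hbound : ∀ s : ℝ, ‖∫ x, inner ℝ (fderiv ℝ φ (x + s • e) e) (u x)‖
        ≤ (eLpNorm φ 2 volume).toReal * V := by
      intro s
      have hφs : ContDiff ℝ ∞ fun x => φ (x + s • e) := hφ.comp (contDiff_id.add contDiff_const)
      have hcs : HasCompactSupport fun x => φ (x + s • e) :=
        hc.comp_homeomorph (Homeomorph.addRight (s • e))
      have h3 := h.integral_inner hul hvl hφs hcs
      simp only [fderiv_comp_add_right] at h3
      rw [h3, norm_neg, Real.norm_eq_abs]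
      refine (abs_integral_inner_le (hφL.comp_add_smul e s) hv).trans_eq ?_
      rw [eLpNorm_comp_add hφL.1]
    have mv := Convex.norm_image_sub_le_of_norm_hasDerivWithin_le (s := Set.univ)
      (fun s _ => (hder s).hasDerivWithinAt) (fun s _ => hbound s) convex_univ
      (Set.mem_univ 0) (Set.mem_univ (-t))
    have e1 : ∫ x, inner ℝ (φ x) (u (x + t • e)) = ∫ x, inner ℝ (φ (x + (-t) • e)) (u x) := by
      rw [← integral_add_right_eq_self (μ := volume)
        (fun x => inner ℝ (φ (x + (-t) • e)) (u x)) (t • e)]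
      simp
    have i1 : Integrable fun x => inner ℝ (φ x) (u (x + t • e)) :=
      (L2.integrable_inner (𝕜 := ℝ) (hφL.toLp φ) ((hu.comp_add_smul e t).toLp _)).congr (by
        filter_upwards [hφL.coeFn_toLp, (hu.comp_add_smul e t).coeFn_toLp] with x h1 h2
        rw [h1, h2])
    have i2 : Integrable fun x => inner ℝ (φ x) (u x) :=
      (L2.integrable_inner (𝕜 := ℝ) (hφL.toLp φ) (hu.toLp _)).congr (by
        filter_upwards [hφL.coeFn_toLp, hu.coeFn_toLp] with x h1 h2
        rw [h1, h2])
    simp only [inner_sub_right]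
    rw [integral_sub i1 i2, e1]
    simp only [Real.norm_eq_abs, zero_smul, add_zero, sub_zero, abs_neg] at mv
    calc _ ≤ _ := mv
      _ = _ := by ring
  -- density
  have dense : ∀ g : Lp F 2 (volume : Measure E),
      |inner ℝ g (hG.toLp _)| ≤ V * |t| * ‖g‖ := by
    intro g
    have hD := Lp.dense_hasCompactSupport_contDiff (E := E) (F := F) (μ := volume) (p := 2)
      ENNReal.ofNat_ne_top
    refine hD.induction (P := fun g => |inner ℝ g (hG.toLp _)| ≤ V * |t| * ‖g‖) ?_ ?_ g
    · rintro f ⟨φ, hfφ, hc, hφ⟩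
      have := test φ hφ hc
      rw [L2.inner_def, Lp.norm_def, eLpNorm_congr_ae hfφ]
      refine le_of_eq_of_le ?_ this
      congr 1
      refine integral_congr_ae ?_
      filter_upwards [hfφ, hG.coeFn_toLp] with x h1 h2
      rw [h1, h2]
    · exact isClosed_le (by fun_prop) (by fun_prop)
  have h4 := dense (hG.toLp _)
  rw [real_inner_self_eq_norm_sq, abs_of_nonneg (by positivity), sq] at h4
  have h5 : ‖hG.toLp _‖ ≤ V * |t| := by
    by_contra hlt
    push Not at hlt
    have : 0 < ‖hG.toLp _‖ := lt_of_le_of_lt (by positivity) hlt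
    exact absurd h4 (not_le.mpr (mul_lt_mul_of_pos_right hlt this))
  rw [Lp.norm_toLp] at h5
  rw [ENNReal.coe_toNNReal hv.2.ne, ← ENNReal.ofReal_toReal hG.2.ne]
  refine (ENNReal.ofReal_le_ofReal h5).trans_eq ?_
  rw [ENNReal.ofReal_mul (by positivity), ENNReal.ofReal_toReal hv.2.ne, ← Real.norm_eq_abs,
    ofReal_norm]

/-- The weak derivative is a weak-* limit of difference quotients, which lie in a ball that is
compact by Banach-Alaoglu. A limit along an ultrafilter suffices, so no subsequence is needed. -/
theorem HasDiffBound.exists_hasWeakDeriv {u : E → F} {e : E} {C : ℝ≥0} (h : HasDiffBound u e C)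
    (hu : MemLp u 2 volume) : ∃ v : E → F, MemLp v 2 volume ∧ HasWeakDeriv u v e := by
  have hul := hu.locallyIntegrable one_le_two
  have hG : ∀ n : ℕ, MemLp (fun x => u (x + ((n : ℝ) + 1)⁻¹ • e) - u x) 2 volume :=
    fun n => (hu.comp_add_smul e _).sub hu
  let d : ℕ → Lp F 2 (volume : Measure E) := fun n => ((n : ℝ) + 1) • (hG n).toLp _
  have hd : ∀ n, ‖d n‖ ≤ C := by
    intro n
    have hn : (0 : ℝ) < (n : ℝ) + 1 := by positivity
    have h1 := ENNReal.toReal_mono (by finiteness) (h (((n : ℝ) + 1)⁻¹))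
    rw [norm_smul, Lp.norm_toLp, Real.norm_of_nonneg hn.le]
    rw [ENNReal.toReal_mul, ENNReal.coe_toReal, toReal_enorm, norm_inv,
      Real.norm_of_nonneg hn.le] at h1
    calc _ ≤ ((n : ℝ) + 1) * (C * ((n : ℝ) + 1)⁻¹) := by gcongr
      _ = C := by field_simp
  let D : ℕ → WeakDual ℝ (Lp F 2 (volume : Measure E)) := fun n =>
    StrongDual.toWeakDual (InnerProductSpace.toDual ℝ _ (d n))
  have hcomp := WeakDual.isCompact_closedBall (𝕜 := ℝ)
    (0 : StrongDual ℝ (Lp F 2 (volume : Measure E))) C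
  let U : Ultrafilter ℕ := Ultrafilter.of atTop
  have hU : (U : Filter ℕ) ≤ atTop := Ultrafilter.of_le atTop
  obtain ⟨w, -, hw⟩ := hcomp.ultrafilter_le_nhds (U.map D) (by
    rw [Ultrafilter.coe_map, le_principal_iff]
    refine Filter.mem_map.mpr (Filter.univ_mem' fun n => ?_)
    simpa [D] using hd n)
  let v : Lp F 2 (volume : Measure E) :=
    (InnerProductSpace.toDual ℝ _).symm (WeakDual.toStrongDual w)
  refine ⟨v, Lp.memLp v, fun φ hφ hc => ?_⟩
  have hfc : Continuous fun x => fderiv ℝ φ x e :=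
    (hφ.continuous_fderiv (by simp)).clm_apply continuous_const
  have hfcc : HasCompactSupport fun x => fderiv ℝ φ x e :=
    hc.fderiv_apply ℝ e
  have i1 := hul.integrable_smul_left_of_hasCompactSupport hfc hfcc
  have i2 := ((Lp.memLp v).locallyIntegrable one_le_two).integrable_smul_left_of_hasCompactSupport
    hφ.continuous hc
  refine ext_inner_left ℝ fun c => ?_
  rw [inner_neg_right, ← _root_.integral_inner i1, ← _root_.integral_inner i2]
  -- the vector valued test function `φ c`
  have hφc : ContDiff ℝ ∞ fun x => φ x • c := hφ.smul contDiff_const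
  have hcc : HasCompactSupport fun x => φ x • c := hc.smul_right
  have hφL : MemLp (fun x => φ x • c) 2 volume := hφc.continuous.memLp_of_hasCompactSupport hcc
  have hder := hasDerivAt_integral_inner_translate hul (hφc.of_le (by simp)) hcc e 0
  have hfd : ∀ x, fderiv ℝ (fun x => φ x • c) x e = fderiv ℝ φ x e • c := by
    intro x
    rw [fderiv_smul_const ((hφ.differentiable (by simp)) x)]
    simp
  simp only [zero_smul, add_zero, hfd] at hder
  have t1 : Tendsto (fun n => inner ℝ (d n) (hφL.toLp _)) U (𝓝 (inner ℝ v (hφL.toLp _))) := by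
    have h1 : Tendsto D U (𝓝 w) := hw
    have h2 := ((WeakDual.eval_continuous (𝕜 := ℝ) (hφL.toLp _)).tendsto w).comp h1
    have e1 : inner ℝ v (hφL.toLp _) = w (hφL.toLp _) := by
      rw [← InnerProductSpace.toDual_apply_apply]
      simp [v]
    rw [e1]
    refine h2.congr fun n => ?_
    simp [D]
  -- Moving the translation from `u` to the test function reverses the step, hence the sign here and
  -- in `hslope`.
  have hseq : Tendsto (fun n : ℕ => -((n : ℝ) + 1)⁻¹) atTop (𝓝[≠] 0) := by
    refine tendsto_nhdsWithin_iff.mpr ⟨?_, .of_forall fun n => ?_⟩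
    · simpa [one_div] using (tendsto_one_div_add_atTop_nhds_zero_nat (𝕜 := ℝ)).neg
    · simp only [Set.mem_compl_iff, Set.mem_singleton_iff, neg_eq_zero, inv_eq_zero]
      positivity
  have t2 := (hder.tendsto_slope.comp hseq).neg
  have i3 : Integrable fun x => inner ℝ (φ x • c) (u x) :=
    (L2.integrable_inner (𝕜 := ℝ) (hφL.toLp _) (hu.toLp _)).congr (by
      filter_upwards [hφL.coeFn_toLp, hu.coeFn_toLp] with x h1 h2
      rw [h1, h2])
  have hslope : ∀ n : ℕ, inner ℝ (d n) (hφL.toLp _)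
      = -(slope (fun r : ℝ => ∫ x, inner ℝ (φ (x + r • e) • c) (u x)) 0 (-((n : ℝ) + 1)⁻¹)) := by
    intro n
    have i4 : Integrable fun x => inner ℝ (φ x • c) (u (x + ((n : ℝ) + 1)⁻¹ • e)) :=
      (L2.integrable_inner (𝕜 := ℝ) (hφL.toLp _) ((hu.comp_add_smul e _).toLp _)).congr (by
        filter_upwards [hφL.coeFn_toLp, (hu.comp_add_smul e ((n : ℝ) + 1)⁻¹).coeFn_toLp]
          with x h1 h2
        rw [h1, h2])
    have e1 : ∫ x, inner ℝ (φ x • c) (u (x + ((n : ℝ) + 1)⁻¹ • e))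
        = ∫ x, inner ℝ (φ (x + (-((n : ℝ) + 1)⁻¹) • e) • c) (u x) := by
      rw [← integral_add_right_eq_self (μ := volume)
        (fun x => inner ℝ (φ (x + (-((n : ℝ) + 1)⁻¹) • e) • c) (u x)) (((n : ℝ) + 1)⁻¹ • e)]
      simp
    have e2 : inner ℝ (d n) (hφL.toLp _) = ((n : ℝ) + 1) *
        ∫ x, inner ℝ (φ x • c) (u (x + ((n : ℝ) + 1)⁻¹ • e) - u x) := by
      rw [real_inner_comm, inner_smul_right, L2.inner_def]
      congr 1
      refine integral_congr_ae ?_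
      filter_upwards [hφL.coeFn_toLp, (hG n).coeFn_toLp] with x h1 h2
      rw [h1, h2]
    rw [e2]
    simp only [inner_sub_right]
    rw [integral_sub i4 i3, e1, slope_def_field]
    have hn : ((n : ℝ) + 1) ≠ 0 := by positivity
    simp only [zero_smul, add_zero, sub_zero]
    field_simp
  have t3 := tendsto_nhds_unique (t1.congr hslope) (t2.mono_left hU)
  rw [L2.inner_def] at t3
  have e3 : ∫ x, inner ℝ (v x) ((hφL.toLp _) x) = ∫ x, inner ℝ c (φ x • v x) := by
    refine integral_congr_ae ?_
    filter_upwards [hφL.coeFn_toLp] with x h1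
    rw [h1, inner_smul_right, inner_smul_right, real_inner_comm]
  rw [e3] at t3
  rw [t3, neg_neg]
  congr 1; ext x
  rw [inner_smul_right, inner_smul_left]; rfl

/-- Difference quotients pass directly through moduli, products and marginals, so no chain rule for
weak derivatives is required below. -/
theorem memH1_iff {u : E → F} :
    MemH1 u ↔ MemLp u 2 volume ∧ ∀ e : E, ∃ C : ℝ≥0, HasDiffBound u e C := by
  refine ⟨fun h => ⟨h.1, fun e => ?_⟩, fun h => ⟨h.1, fun e => ?_⟩⟩
  · obtain ⟨v, hv, hd⟩ := h.2 e
    exact ⟨_, hd.hasDiffBound h.1 hv⟩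
  · obtain ⟨C, hC⟩ := h.2 e
    exact hC.exists_hasWeakDeriv h.1

end DifferenceQuotients

/-! ### Integration over products of copies of a measure space. -/

section ProductIntegrals

variable {α : Type*} [MeasurableSpace α] (μ : Measure α) [SigmaFinite μ]

theorem measurable_finCons {n : ℕ} :
    Measurable fun p : α × (Fin n → α) => (Fin.cons p.1 p.2 : Fin (n + 1) → α) := by
  refine measurable_pi_iff.mpr fun i => ?_
  refine Fin.cases ?_ (fun j => ?_) i
  · simpa using measurable_fst
  · simpa using! (measurable_pi_apply j).comp measurable_snd

theorem measurePreserving_finCons {n : ℕ} :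
    MeasurePreserving (fun p : α × (Fin n → α) => (Fin.cons p.1 p.2 : Fin (n + 1) → α))
      (μ.prod (Measure.pi fun _ => μ)) (Measure.pi fun _ => μ) := by
  have h := (measurePreserving_piFinSuccAbove (fun _ : Fin (n + 1) => μ) 0).symm
  convert h using 1
  ext p i
  simp [MeasurableEquiv.piFinSuccAbove, Fin.insertNthEquiv]

theorem lintegral_finCons {n : ℕ} {f : (Fin (n + 1) → α) → ℝ≥0∞}
    (hf : AEMeasurable f (Measure.pi fun _ => μ)) :
    ∫⁻ x, f x ∂(Measure.pi fun _ => μ)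
      = ∫⁻ a, ∫⁻ y : Fin n → α, f (Fin.cons a y) ∂(Measure.pi fun _ => μ) ∂μ := by
  have hp := measurePreserving_finCons μ (n := n)
  have hf' := hf
  rw [← hp.map_eq] at hf'
  rw [← hp.map_eq, lintegral_map' hf' hp.measurable.aemeasurable,
    lintegral_prod (fun p : α × (Fin n → α) => f (Fin.cons p.1 p.2))
      (hf'.comp_measurable hp.measurable)]

theorem lintegral_pi_prod {n : ℕ} {f : Fin n → α → ℝ≥0∞} (hf : ∀ i, AEMeasurable (f i) μ) :
    ∫⁻ x : Fin n → α, ∏ i, f i (x i) ∂(Measure.pi fun _ => μ) = ∏ i, ∫⁻ a, f i a ∂μ := by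
  induction n with
  | zero => simp
  | succ n ih =>
    have hm : AEMeasurable (fun x : Fin (n + 1) → α => ∏ i, f i (x i)) (Measure.pi fun _ => μ) :=
      Finset.aemeasurable_fun_prod _ fun i _ =>
        (hf i).comp_quasiMeasurePreserving (Measure.quasiMeasurePreserving_eval _ i)
    rw [lintegral_finCons μ hm]
    simp only [Fin.prod_univ_succ, Fin.cons_zero, Fin.cons_succ]
    have hm' : ∀ i : Fin n, AEMeasurable (fun x : Fin n → α => f i.succ (x i))
        (Measure.pi fun _ => μ) := fun i =>
      (hf i.succ).comp_quasiMeasurePreserving (Measure.quasiMeasurePreserving_eval _ i)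
    simp_rw [lintegral_const_mul'' _ (Finset.aemeasurable_fun_prod _ fun i _ => hm' i),
      ih fun i => hf i.succ]
    rw [lintegral_mul_const'' _ (hf 0)]

/-- Absorbs a product weight into the measure, so that a map transporting the one-particle weight
can be applied in all variables at once. -/
theorem lintegral_pi_prod_mul {n : ℕ} {f : α → ℝ≥0∞} (hf : Measurable f)
    [SigmaFinite (μ.withDensity f)] {G : (Fin n → α) → ℝ≥0∞} (hG : Measurable G) :
    ∫⁻ x : Fin n → α, (∏ i, f (x i)) * G x ∂(Measure.pi fun _ => μ)
      = ∫⁻ x, G x ∂(Measure.pi fun _ => μ.withDensity f) := by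
  induction n with
  | zero =>
    rw [Measure.pi_of_empty (fun _ : Fin 0 => μ), Measure.pi_of_empty (fun _ : Fin 0 => _)]
    simp
  | succ n ih =>
    have hm : Measurable fun x : Fin (n + 1) → α => (∏ i, f (x i)) * G x :=
      (Finset.measurable_fun_prod _ fun i _ => hf.comp (measurable_pi_apply i)).mul hG
    rw [lintegral_finCons μ hm.aemeasurable, lintegral_finCons _ hG.aemeasurable,
      lintegral_withDensity_eq_lintegral_mul _ hf]
    · refine lintegral_congr fun a => ?_
      have hGa : Measurable fun y : Fin n → α => G (Fin.cons a y) :=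
        hG.comp (measurable_finCons.comp measurable_prodMk_left)
      simp only [Fin.prod_univ_succ, Fin.cons_zero, Fin.cons_succ, mul_assoc, Pi.mul_apply]
      have hp : Measurable fun y : Fin n → α => (∏ i, f (y i)) * G (Fin.cons a y) :=
        (Finset.measurable_fun_prod _ fun i _ => hf.comp (measurable_pi_apply i)).mul hGa
      rw [lintegral_const_mul _ hp, ih hGa]
    · exact (hG.comp measurable_finCons).lintegral_prod_right'

theorem eLpNorm_two_sq {F : Type*} [NormedAddCommGroup F] (ν : Measure α) (f : α → F) :
    eLpNorm f 2 ν ^ 2 = ∫⁻ x, ‖f x‖ₑ ^ 2 ∂ν := by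
  have := eLpNorm_nnreal_pow_eq_lintegral (f := f) (μ := ν) (p := 2) two_ne_zero
  simpa using! this

theorem eLpNorm_two_le_iff {F : Type*} [NormedAddCommGroup F] (ν : Measure α) (f : α → F)
    (c : ℝ≥0∞) : eLpNorm f 2 ν ≤ c ↔ ∫⁻ x, ‖f x‖ₑ ^ 2 ∂ν ≤ c ^ 2 := by
  rw [← eLpNorm_two_sq, ENNReal.pow_le_pow_left_iff two_ne_zero]

end ProductIntegrals

/-! ### Stability of difference quotient bounds. -/

section DiffBoundClosure

variable {E F : Type*} [NormedAddCommGroup E] [NormedSpace ℝ E] [MeasureSpace E]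
  [BorelSpace E] [(volume : Measure E).IsAddHaarMeasure] [NormedAddCommGroup F]

theorem ae_comp_add {p : E → Prop} (h : ∀ᵐ x, p x) (y : E) : ∀ᵐ x, p (x + y) :=
  (measurePreserving_add_right volume y).quasiMeasurePreserving.ae h

theorem aestronglyMeasurable_comp_add {u : E → F} (hu : AEStronglyMeasurable u volume) (y : E) :
    AEStronglyMeasurable (fun x => u (x + y)) volume :=
  hu.comp_measurePreserving (measurePreserving_add_right volume y)

theorem HasDiffBound.congr {u v : E → F} {e : E} {C : ℝ≥0} (h : HasDiffBound u e C)
    (huv : u =ᵐ[volume] v) : HasDiffBound v e C := by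
  intro t
  refine le_of_eq_of_le (eLpNorm_congr_ae ?_) (h t)
  filter_upwards [huv, ae_comp_add huv (t • e)] with x h1 h2
  rw [h1, h2]

/-- Translate in two steps and use translation invariance of the norm. This reduces directions in
configuration space to motions of a single particle. -/
theorem HasDiffBound.add_dir {u : E → F} {e₁ e₂ : E} {C₁ C₂ : ℝ≥0}
    (hu : AEStronglyMeasurable u volume) (h₁ : HasDiffBound u e₁ C₁) (h₂ : HasDiffBound u e₂ C₂) :
    HasDiffBound u (e₁ + e₂) (C₁ + C₂) := by
  intro t
  have m1 := aestronglyMeasurable_comp_add hu (t • e₁)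
  have m2 : AEStronglyMeasurable (fun x => u (x + t • e₂ + t • e₁) - u (x + t • e₂)) volume :=
    aestronglyMeasurable_comp_add (u := fun x => u (x + t • e₁) - u x) (m1.sub hu) (t • e₂)
  have e : (fun x => u (x + t • (e₁ + e₂)) - u x)
      = (fun x => u (x + t • e₂ + t • e₁) - u (x + t • e₂)) + fun x => u (x + t • e₂) - u x := by
    ext x
    simp only [Pi.add_apply, sub_add_sub_cancel, smul_add]
    rw [add_assoc, add_comm (t • e₂)]
  rw [e]
  refine (eLpNorm_add_le m2 ((aestronglyMeasurable_comp_add hu _).sub hu) one_le_two).trans ?_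
  have e2 : eLpNorm (fun x => u (x + t • e₂ + t • e₁) - u (x + t • e₂)) 2 volume
      = eLpNorm (fun x => u (x + t • e₁) - u x) 2 volume :=
    eLpNorm_comp_measurePreserving (g := fun x => u (x + t • e₁) - u x) (m1.sub hu)
      (measurePreserving_add_right volume (t • e₂))
  rw [e2, ENNReal.coe_add, add_mul]
  exact add_le_add (h₁ t) (h₂ t)

theorem HasDiffBound.zero_dir (u : E → F) : HasDiffBound u 0 0 := by
  intro t
  simp

theorem exists_hasDiffBound_sum_dir {ι : Type*} {u : E → F} (hu : AEStronglyMeasurable u volume)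
    (s : Finset ι) (e : ι → E) (h : ∀ i ∈ s, ∃ C, HasDiffBound u (e i) C) :
    ∃ C, HasDiffBound u (∑ i ∈ s, e i) C := by
  classical
  induction s using Finset.induction_on with
  | empty => exact ⟨0, by simpa using HasDiffBound.zero_dir u⟩
  | insert a s ha ih =>
    obtain ⟨C₁, h₁⟩ := h a (Finset.mem_insert_self a s)
    obtain ⟨C₂, h₂⟩ := ih fun i hi => h i (Finset.mem_insert_of_mem hi)
    rw [Finset.sum_insert ha]
    exact ⟨_, h₁.add_dir hu h₂⟩

/-- Multiplication by a bounded function `g` that is Lipschitz in the direction `e`. -/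
theorem HasDiffBound.lipschitz_smul [NormedSpace ℝ F] {u : E → F} {g : E → ℝ} {e : E} {C K : ℝ≥0}
    (h : HasDiffBound u e C) (hu : MemLp u 2 volume) (hg : AEStronglyMeasurable g volume)
    (hg1 : ∀ x, |g x| ≤ 1) (hgK : ∀ x (t : ℝ), |g (x + t • e) - g x| ≤ K * |t|) :
    HasDiffBound (fun x => g x • u x) e (C + K * (eLpNorm u 2 volume).toNNReal) := by
  intro t
  have m1 := aestronglyMeasurable_comp_add hu.1 (t • e)
  have m2 := aestronglyMeasurable_comp_add hg (t • e)
  -- In this discrete product rule the bound for `u` keeps the factor `1`; if `g` is constant along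
  -- `e`, the constant `C` does not change.
  have e1 : (fun x => g (x + t • e) • u (x + t • e) - g x • u x)
      = (fun x => g (x + t • e) • (u (x + t • e) - u x))
        + fun x => (g (x + t • e) - g x) • u x := by
    ext x
    simp only [Pi.add_apply, smul_sub, sub_smul]
    abel
  rw [e1]
  refine (eLpNorm_add_le (m2.smul (m1.sub hu.1)) ((m2.sub hg).smul hu.1) one_le_two).trans ?_
  rw [ENNReal.coe_add, add_mul]
  refine add_le_add (le_trans (eLpNorm_mono fun x => ?_) (h t)) ?_
  · change ‖g (x + t • e) • (u (x + t • e) - u x)‖ ≤ _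
    rw [norm_smul]
    exact mul_le_of_le_one_left (norm_nonneg _) (hg1 _)
  · have : eLpNorm (fun x => (g (x + t • e) - g x) • u x) 2 volume
        ≤ eLpNorm (fun x => (K * |t|) • u x) 2 volume := by
      refine eLpNorm_mono fun x => ?_
      rw [norm_smul, norm_smul, Real.norm_eq_abs, Real.norm_of_nonneg (by positivity)]
      gcongr
      exact hgK x t
    refine this.trans ((eLpNorm_const_smul _ _ _ _).le.trans_eq ?_)
    rw [enorm_mul, ENNReal.coe_mul, ENNReal.coe_toNNReal hu.2.ne]
    rw [Real.enorm_eq_ofReal (NNReal.coe_nonneg K), ENNReal.ofReal_coe_nnreal,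
      Real.enorm_abs]
    ring

theorem MeasureTheory.MemLp.bounded_smul [NormedSpace ℝ F] {u : E → F} {g : E → ℝ}
    (hu : MemLp u 2 volume) (hg : AEStronglyMeasurable g volume) (hg1 : ∀ x, |g x| ≤ 1) :
    MemLp (fun x => g x • u x) 2 volume :=
  hu.mono (hg.smul hu.1) (.of_forall fun x => by
    rw [norm_smul]; exact mul_le_of_le_one_left (norm_nonneg _) (hg1 x))

/-- The pointwise Euclidean norm of a finite family of functions. -/
theorem HasDiffBound.sqrt_sum_sq {ι : Type*} [Fintype ι] {u : ι → E → F} {e : E} {C : ι → ℝ≥0}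
    (h : ∀ i, HasDiffBound (u i) e (C i)) (hu : ∀ i, AEStronglyMeasurable (u i) volume) :
    HasDiffBound (fun x => ((√(∑ i, ‖u i x‖ ^ 2) : ℝ) : ℂ)) e (∑ i, C i) := by
  intro t
  have m : ∀ i, AEStronglyMeasurable (fun x => ‖u i (x + t • e) - u i x‖) volume := fun i =>
    ((aestronglyMeasurable_comp_add (hu i) (t • e)).sub (hu i)).norm
  -- As a Euclidean norm the root obeys the reverse triangle inequality; then the `ℓ²` norm is
  -- bounded by the `ℓ¹` norm.
  have hsqrt : ∀ x, √(∑ i, ‖u i x‖ ^ 2)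
      = ‖(WithLp.toLp 2 fun i => ‖u i x‖ : EuclideanSpace ℝ ι)‖ := fun x => by
    simp [EuclideanSpace.norm_eq]
  calc _ ≤ eLpNorm (fun x => ∑ i, ‖u i (x + t • e) - u i x‖) 2 volume := by
        refine eLpNorm_mono_real fun x => ?_
        rw [← Complex.ofReal_sub, Complex.norm_real, hsqrt, hsqrt]
        refine (abs_norm_sub_norm_le _ _).trans ?_
        rw [EuclideanSpace.norm_eq]
        refine (Real.sqrt_le_sqrt ?_).trans
          (Real.sqrt_le_iff.mpr ⟨Finset.sum_nonneg fun i _ => norm_nonneg _,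
            Finset.sum_sq_le_sq_sum_of_nonneg fun i _ => norm_nonneg
              (u i (x + t • e) - u i x)⟩)
        refine Finset.sum_le_sum fun i _ => ?_
        refine pow_le_pow_left₀ (norm_nonneg _) ?_ 2
        exact abs_norm_sub_norm_le _ _
    _ ≤ ∑ i, eLpNorm (fun x => ‖u i (x + t • e) - u i x‖) 2 volume := by
        have := eLpNorm_sum_le (μ := volume) (p := 2) (s := Finset.univ)
          (f := fun i x => ‖u i (x + t • e) - u i x‖) (fun i _ => m i) one_le_two
        refine le_of_eq_of_le ?_ this
        congr 1; ext x; simp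
    _ ≤ ∑ i, C i * ‖t‖ₑ := by
        refine Finset.sum_le_sum fun i _ => ?_
        rw [eLpNorm_norm]
        exact h i t
    _ = _ := by rw [ENNReal.ofNNReal_finsetSum, Finset.sum_mul]

end DiffBoundClosure

/-! ### The square root of the one-body density. -/

section Marginals

variable {n : ℕ}

theorem measurePreserving_configCons :
    MeasurePreserving (fun p : Space × Config n => (Fin.cons p.1 p.2 : Config (n + 1)))
      (volume.prod volume) volume :=
  measurePreserving_finCons volume

theorem lintegral_configCons {f : Config (n + 1) → ℝ≥0∞} (hf : AEMeasurable f volume) :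
    ∫⁻ x, f x = ∫⁻ a : Space, ∫⁻ y : Config n, f (Fin.cons a y) :=
  lintegral_finCons volume hf

theorem lintegral_oneBodyDensity {Φ : Config (n + 1) → ℂ} (hΦ : AEStronglyMeasurable Φ volume) :
    ∫⁻ x, oneBodyDensity Φ x = ((n + 1 : ℕ) : ℝ≥0∞) * ∫⁻ x, ‖Φ x‖ₑ ^ 2 := by
  simp only [oneBodyDensity]
  rw [lintegral_const_mul' _ _ (by finiteness), lintegral_configCons (hΦ.enorm.pow_const 2)]

theorem aemeasurable_oneBodyDensity {Φ : Config (n + 1) → ℂ}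
    (hΦ : AEStronglyMeasurable Φ volume) : AEMeasurable (oneBodyDensity Φ) volume := by
  have h : AEMeasurable (fun p : Space × Config n => ‖Φ (Fin.cons p.1 p.2)‖ₑ ^ 2)
      (volume.prod volume) :=
    ((hΦ.comp_measurePreserving measurePreserving_configCons).enorm).pow_const 2
  exact h.lintegral_prod_right'.const_mul _

/-- The square root of the one-body density. -/
def sqrtDensity (Φ : Config (n + 1) → ℂ) (x : Space) : ℝ :=
  √(oneBodyDensity Φ x).toReal

theorem oneBodyDensity_lt_top {Φ : Config (n + 1) → ℂ} (hΦ : MemLp Φ 2 volume) :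
    ∀ᵐ x, oneBodyDensity Φ x < ⊤ := by
  refine ae_lt_top' (aemeasurable_oneBodyDensity hΦ.1) ?_
  rw [lintegral_oneBodyDensity hΦ.1, ← eLpNorm_two_sq]
  exact ENNReal.mul_ne_top (by finiteness) (ENNReal.pow_ne_top hΦ.2.ne)

theorem ofReal_sqrtDensity_sq {Φ : Config (n + 1) → ℂ} (hΦ : MemLp Φ 2 volume) :
    ∀ᵐ x, ENNReal.ofReal (sqrtDensity Φ x ^ 2) = oneBodyDensity Φ x := by
  filter_upwards [oneBodyDensity_lt_top hΦ] with x hx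
  rw [sqrtDensity, Real.sq_sqrt ENNReal.toReal_nonneg, ENNReal.ofReal_toReal hx.ne]

theorem aestronglyMeasurable_sqrtDensity {Φ : Config (n + 1) → ℂ}
    (hΦ : AEStronglyMeasurable Φ volume) : AEStronglyMeasurable (sqrtDensity Φ) volume :=
  ((aemeasurable_oneBodyDensity hΦ).ennreal_toReal.sqrt).aestronglyMeasurable

theorem eLpNorm_sqrtDensity_sq {Φ : Config (n + 1) → ℂ} (hΦ : MemLp Φ 2 volume) :
    eLpNorm (sqrtDensity Φ) 2 volume ^ 2
      = ((n + 1 : ℕ) : ℝ≥0∞) * eLpNorm Φ 2 volume ^ 2 := by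
  rw [eLpNorm_two_sq, eLpNorm_two_sq, ← lintegral_oneBodyDensity hΦ.1]
  refine lintegral_congr_ae ?_
  filter_upwards [ofReal_sqrtDensity_sq hΦ] with x hx
  have h0 : 0 ≤ sqrtDensity Φ x := Real.sqrt_nonneg _
  rw [← hx, Real.enorm_eq_ofReal h0, ENNReal.ofReal_pow h0]

theorem memLp_sqrtDensity {Φ : Config (n + 1) → ℂ} (hΦ : MemLp Φ 2 volume) :
    MemLp (sqrtDensity Φ) 2 volume := by
  refine ⟨aestronglyMeasurable_sqrtDensity hΦ.1, ?_⟩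
  have h : eLpNorm (sqrtDensity Φ) 2 volume ^ 2 < ⊤ := by
    rw [eLpNorm_sqrtDensity_sq hΦ]
    exact ENNReal.mul_lt_top (by finiteness) (ENNReal.pow_lt_top hΦ.2)
  exact lt_top_iff_ne_top.mpr fun h' => by simp [h'] at h

theorem abs_toReal_eLpNorm_sub_le {α : Type*} [MeasurableSpace α] {μ : Measure α} {f g : α → ℂ}
    (hf : MemLp f 2 μ) (hg : MemLp g 2 μ) :
    |(eLpNorm f 2 μ).toReal - (eLpNorm g 2 μ).toReal|
      ≤ (eLpNorm (fun x => f x - g x) 2 μ).toReal := by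
  have := abs_norm_sub_norm_le (hf.toLp f) (hg.toLp g)
  rw [← MemLp.toLp_sub, Lp.norm_toLp, Lp.norm_toLp, Lp.norm_toLp] at this
  exact this

theorem sqrtDensity_eq (Φ : Config (n + 1) → ℂ) (x : Space) :
    sqrtDensity Φ x = √(n + 1)
      * (eLpNorm (fun y : Config n => Φ (Fin.cons x y)) 2 volume).toReal := by
  rw [sqrtDensity, oneBodyDensity, ← eLpNorm_two_sq, ENNReal.toReal_mul, ENNReal.toReal_pow,
    Real.sqrt_mul (by positivity), Real.sqrt_sq ENNReal.toReal_nonneg, ENNReal.toReal_natCast,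
    Nat.cast_succ]

/-- Up to the factor `√N`, the root of the density at `x` is the `L²` norm of the slice of `Φ` at
`x`. The reverse triangle inequality for that norm gives a Hoffmann-Ostenhof type bound. -/
theorem HasDiffBound.sqrtDensity {Φ : Config (n + 1) → ℂ} (hΦ : MemLp Φ 2 volume) {e : Space}
    {C : ℝ≥0} (h : HasDiffBound Φ (Pi.single 0 e) C) :
    HasDiffBound (sqrtDensity Φ) e (NNReal.sqrt (n + 1) * C) := by
  intro t
  have hm : ∀ᵐ x : Space, MemLp (fun y : Config n => Φ (Fin.cons x y)) 2 volume := by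
    have h1 : AEStronglyMeasurable (fun p : Space × Config n => Φ (Fin.cons p.1 p.2))
      (volume.prod volume) := hΦ.1.comp_measurePreserving measurePreserving_configCons
    filter_upwards [h1.prodMk_left, oneBodyDensity_lt_top hΦ] with x hx hx'
    refine ⟨hx, lt_top_iff_ne_top.mpr fun h' => ?_⟩
    rw [oneBodyDensity, ← eLpNorm_two_sq, h'] at hx'
    simp at hx'
  have hsub : AEStronglyMeasurable
      (fun z => Φ (z + t • (Pi.single 0 e : Config (n + 1))) - Φ z) volume :=
    (aestronglyMeasurable_comp_add hΦ.1 (t • (Pi.single 0 e : Config (n + 1)))).sub hΦ.1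
  have hcons : ∀ (x : Space) (y : Config n),
      (Fin.cons x y : Config (n + 1)) + t • (Pi.single 0 e : Config (n + 1)) =
        Fin.cons (x + t • e) y := by
    intro x y
    ext i : 1
    refine Fin.cases ?_ (fun j => ?_) i <;> simp
  have key : ∀ᵐ x : Space, ‖_root_.sqrtDensity Φ (x + t • e) - _root_.sqrtDensity Φ x‖ₑ ^ 2
      ≤ ((n + 1 : ℕ) : ℝ≥0∞) *
        ∫⁻ y : Config n, ‖Φ (Fin.cons (x + t • e) y) - Φ (Fin.cons x y)‖ₑ ^ 2 := by
    filter_upwards [hm, ae_comp_add hm (t • e)] with x h1 h2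
    rw [sqrtDensity_eq, sqrtDensity_eq, ← mul_sub, enorm_mul, mul_pow, ← eLpNorm_two_sq]
    gcongr
    · rw [Real.enorm_eq_ofReal (Real.sqrt_nonneg _), ← ENNReal.ofReal_pow (Real.sqrt_nonneg _),
        Real.sq_sqrt (by positivity)]
      norm_cast
    · rw [← Real.enorm_abs, Real.enorm_eq_ofReal (abs_nonneg _)]
      exact ENNReal.ofReal_le_of_le_toReal (abs_toReal_eLpNorm_sub_le h2 h1)
  rw [eLpNorm_two_le_iff]
  refine (lintegral_mono_ae key).trans ?_
  rw [lintegral_const_mul' _ _ (by finiteness)]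
  have h3 := (eLpNorm_two_le_iff _ _ _).mp (h t)
  rw [lintegral_configCons (hsub.enorm.pow_const 2)] at h3
  simp only [hcons] at h3
  rw [ENNReal.coe_mul, mul_assoc, mul_pow]
  gcongr
  rw [← ENNReal.coe_pow, NNReal.sq_sqrt]
  simp

end Marginals

/-! ### Tensor powers of a one-particle function. -/

section TensorPower

theorem HasDiffBound.ofReal {E : Type*} [NormedAddCommGroup E] [NormedSpace ℝ E] [MeasureSpace E]
    {u : E → ℝ} {e : E} {C : ℝ≥0} (h : HasDiffBound u e C) :
    HasDiffBound (fun x => (u x : ℂ)) e C := by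
  intro t
  refine le_of_eq_of_le (eLpNorm_congr_norm_ae (.of_forall fun x => ?_)) (h t)
  rw [← Complex.ofReal_sub, Complex.norm_real]

theorem enorm_finsetProd {ι : Type*} (s : Finset ι) (f : ι → ℝ) :
    ‖∏ i ∈ s, f i‖ₑ = ∏ i ∈ s, ‖f i‖ₑ := by
  classical
  induction s using Finset.induction_on with
  | empty => simp
  | insert a s ha ih => rw [Finset.prod_insert ha, Finset.prod_insert ha, enorm_mul, ih]

theorem aestronglyMeasurable_tensor {N : ℕ} {w : Space → ℝ} (hw : AEStronglyMeasurable w volume) :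
    AEStronglyMeasurable (fun x : Config N => ∏ j, w (x j)) volume := by
  refine Finset.aestronglyMeasurable_fun_prod _ fun i _ => ?_
  exact hw.comp_quasiMeasurePreserving (Measure.quasiMeasurePreserving_eval _ i)

theorem lintegral_tensor {N : ℕ} {w : Space → ℝ} (hw : AEStronglyMeasurable w volume) :
    ∫⁻ x : Config N, ‖∏ j, w (x j)‖ₑ ^ 2 = (eLpNorm w 2 volume ^ 2) ^ N := by
  have h := lintegral_pi_prod (volume : Measure Space) (n := N) (f := fun _ x => ‖w x‖ₑ ^ 2)
    fun _ => hw.enorm.pow_const 2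
  rw [Finset.prod_const, Finset.card_univ, Fintype.card_fin, ← eLpNorm_two_sq] at h
  rw [← h]
  refine lintegral_congr fun x => ?_
  rw [enorm_finsetProd, Finset.prod_pow]

theorem memLp_tensor {N : ℕ} {w : Space → ℝ} (hw : MemLp w 2 volume) :
    MemLp (fun x : Config N => ∏ j, w (x j)) 2 volume := by
  refine ⟨aestronglyMeasurable_tensor hw.1, lt_top_iff_ne_top.mpr fun h' => ?_⟩
  have h := lintegral_tensor (N := N) hw.1
  rw [← eLpNorm_two_sq, h', ENNReal.top_pow two_ne_zero] at h
  exact ENNReal.pow_ne_top (ENNReal.pow_ne_top hw.2.ne) h.symm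

/-- Moving one particle alters one factor, so the difference is again a pure product and its norm
factorizes. -/
theorem HasDiffBound.tensor_single {N : ℕ} {w : Space → ℝ} (hw : MemLp w 2 volume) {e : Space}
    {C : ℝ≥0} (h : HasDiffBound w e C) (i : Fin N) :
    ∃ C', HasDiffBound (fun x : Config N => ∏ j, w (x j)) (Pi.single i e) C' := by
  refine ⟨C * ∏ j ∈ Finset.univ.erase i, (eLpNorm w 2 volume).toNNReal, fun t => ?_⟩
  rw [eLpNorm_two_le_iff]
  let g : Fin N → Space → ℝ := fun j x => if j = i then w (x + t • e) - w x else w x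
  have hg : ∀ j, AEStronglyMeasurable (g j) volume := by
    intro j
    by_cases hj : j = i
    · simpa [g, hj] using! (aestronglyMeasurable_comp_add hw.1 _).sub hw.1
    · simpa [g, hj] using hw.1
  have hgi : ∀ x, g i x = w (x + t • e) - w x := fun x => by simp [g]
  have hgj : ∀ j ∈ Finset.univ.erase i, g j = w := fun j hj => by
    ext x; simp [g, Finset.ne_of_mem_erase hj]
  have e1 : ∀ x : Config N, ‖(∏ j, w ((x + t • (Pi.single i e : Config N)) j)) - ∏ j, w (x j)‖ₑ ^ 2
      = ∏ j, ‖g j (x j)‖ₑ ^ 2 := by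
    intro x
    rw [Finset.prod_pow, ← enorm_finsetProd]
    congr 2
    rw [← Finset.mul_prod_erase _ _ (Finset.mem_univ i), ← Finset.mul_prod_erase _ _
      (Finset.mem_univ i), ← Finset.mul_prod_erase _ (fun j => g j (x j)) (Finset.mem_univ i), hgi,
      sub_mul]
    congr 2
    · simp
    · refine Finset.prod_congr rfl fun j hj => ?_
      simp [hgj j hj, Finset.ne_of_mem_erase hj]
    · refine Finset.prod_congr rfl fun j hj => ?_
      rw [hgj j hj]
  simp only [e1]
  have h2 := lintegral_pi_prod (volume : Measure Space) (n := N) (f := fun j x => ‖g j x‖ₑ ^ 2)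
    fun j => (hg j).enorm.pow_const 2
  refine h2.le.trans ?_
  rw [← Finset.mul_prod_erase _ _ (Finset.mem_univ i)]
  have e2 : ∀ j ∈ Finset.univ.erase i, ∫⁻ x, ‖g j x‖ₑ ^ 2 = eLpNorm w 2 volume ^ 2 := fun j hj => by
    rw [hgj j hj, eLpNorm_two_sq]
  rw [Finset.prod_congr rfl e2, Finset.prod_pow, ENNReal.coe_mul, ENNReal.ofNNReal_finsetProd]
  simp only [hgi, ENNReal.coe_toNNReal hw.2.ne]
  rw [mul_right_comm, mul_pow]
  gcongr
  exact (eLpNorm_two_le_iff _ _ _).mp (h t)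

theorem HasDiffBound.tensor {N : ℕ} {w : Space → ℝ} (hw : MemLp w 2 volume)
    (h : ∀ e, ∃ C, HasDiffBound w e C) (v : Config N) :
    ∃ C', HasDiffBound (fun x : Config N => ∏ j, w (x j)) v C' := by
  rw [← Finset.univ_sum_single v]
  refine exists_hasDiffBound_sum_dir (aestronglyMeasurable_tensor hw.1) _ _ fun i _ => ?_
  obtain ⟨C, hC⟩ := h (v i)
  exact hC.tensor_single hw i

end TensorPower

/-! ### Products of bounded Lipschitz functions. -/

section LipschitzProducts

theorem exists_lipschitzWith_prod {ι α : Type*} [PseudoEMetricSpace α] (s : Finset ι)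
    (f : ι → α → ℝ) (h1 : ∀ i ∈ s, ∀ x, |f i x| ≤ 1) (hf : ∀ i ∈ s, ∃ K, LipschitzWith K (f i)) :
    ∃ K, LipschitzWith K fun x => ∏ i ∈ s, f i x := by
  classical
  induction s using Finset.induction_on with
  | empty => exact ⟨0, by simp⟩
  | insert a s ha ih =>
    obtain ⟨K₁, hK₁⟩ := hf a (Finset.mem_insert_self a s)
    obtain ⟨K₂, hK₂⟩ := ih (fun i hi => h1 i (Finset.mem_insert_of_mem hi))
      fun i hi => hf i (Finset.mem_insert_of_mem hi)
    have b1 := h1 a (Finset.mem_insert_self a s)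
    have b2 : ∀ x, |∏ i ∈ s, f i x| ≤ 1 := fun x => by
      rw [Finset.abs_prod]
      exact Finset.prod_le_one (fun i _ => abs_nonneg _)
        fun i hi => h1 i (Finset.mem_insert_of_mem hi) x
    refine ⟨K₁ + K₂, fun x y => ?_⟩
    simp only [Finset.prod_insert ha]
    have e : f a x * ∏ i ∈ s, f i x - f a y * ∏ i ∈ s, f i y
        = (f a x - f a y) * (∏ i ∈ s, f i x) + f a y * (∏ i ∈ s, f i x - ∏ i ∈ s, f i y) := by
      ring
    have le1 : ∀ {r : ℝ}, |r| ≤ 1 → ‖r‖ₑ ≤ 1 := fun {r} hr => by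
      rw [← Real.enorm_abs, Real.enorm_eq_ofReal (abs_nonneg _)]
      simpa using hr
    rw [edist_eq_enorm_sub, e]
    refine (enorm_add_le _ _).trans ?_
    rw [enorm_mul, enorm_mul, ENNReal.coe_add, add_mul, ← edist_eq_enorm_sub, ← edist_eq_enorm_sub]
    refine add_le_add ?_ ?_
    · exact (mul_le_of_le_one_right' (le1 (b2 x))).trans (hK₁ x y)
    · exact (mul_le_of_le_one_left' (le1 (b1 y))).trans (hK₂ x y)

theorem LipschitzWith.abs_add_smul_sub_le {E : Type*} [NormedAddCommGroup E] [NormedSpace ℝ E]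
    {g : E → ℝ} {K : ℝ≥0} (h : LipschitzWith K g) (x e : E) (t : ℝ) :
    |g (x + t • e) - g x| ≤ (K * ‖e‖₊ : ℝ≥0) * |t| := by
  have := h.norm_sub_le (x + t • e) x
  rw [add_sub_cancel_left, norm_smul, Real.norm_eq_abs, Real.norm_eq_abs] at this
  refine this.trans_eq ?_
  push_cast
  ring

/-- `H¹` is stable under multiplication by bounded Lipschitz functions. -/
theorem MemH1.lipschitz_smul {N : ℕ} {u : Config N → ℂ} (hu : MemH1 u) {g : Config N → ℝ} {K : ℝ≥0}
    (hg : LipschitzWith K g) (hg1 : ∀ x, |g x| ≤ 1) : MemH1 fun x => g x • u x := by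
  rw [memH1_iff] at hu ⊢
  refine ⟨hu.1.bounded_smul hg.continuous.aestronglyMeasurable hg1, fun e => ?_⟩
  obtain ⟨C, hC⟩ := hu.2 e
  exact ⟨_, hC.lipschitz_smul hu.1 hg.continuous.aestronglyMeasurable hg1
    fun x t => hg.abs_add_smul_sub_le x e t⟩

end LipschitzProducts

/-! ### The probability integral transform. -/

section IntegralTransform

open ProbabilityTheory

/-- The probability integral transform: a continuous distribution function is uniformly
distributed. -/
theorem map_cdf_eq (μ : Measure ℝ) [IsProbabilityMeasure μ] (hc : Continuous (cdf μ)) :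
    μ.map (cdf μ) = volume.restrict (Set.Ioc 0 1) := by
  refine Measure.ext_of_Iic _ _ fun t => ?_
  rw [Measure.map_apply hc.measurable measurableSet_Iic, Measure.restrict_apply measurableSet_Iic]
  set S := cdf μ ⁻¹' Set.Iic t with hS
  rcases lt_or_ge t 0 with h0 | h0
  · have h1 : S = ∅ := by
      ext s
      simpa [hS] using h0.trans_le (cdf_nonneg μ s)
    have h2 : Set.Iic t ∩ Set.Ioc (0 : ℝ) 1 = ∅ := by
      ext s
      simp only [Set.mem_inter_iff, Set.mem_Iic, Set.mem_Ioc, Set.mem_empty_iff_false, iff_false]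
      intro h; linarith [h.1, h.2.1]
    rw [h1, h2, measure_empty, measure_empty]
  rcases le_or_gt 1 t with h1 | h1
  · have h2 : S = Set.univ := by
      ext s
      simpa [hS] using (cdf_le_one μ s).trans h1
    have h3 : Set.Iic t ∩ Set.Ioc (0 : ℝ) 1 = Set.Ioc 0 1 := by
      ext s
      simp only [Set.mem_inter_iff, Set.mem_Iic, Set.mem_Ioc, and_iff_right_iff_imp]
      intro h; linarith [h.2]
    rw [h2, h3, measure_univ, Real.volume_Ioc]
    simp
  have h3 : Set.Iic t ∩ Set.Ioc (0 : ℝ) 1 = Set.Ioc 0 t := by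
    ext s
    simp only [Set.mem_inter_iff, Set.mem_Iic, Set.mem_Ioc]
    constructor
    · rintro ⟨a, b, c⟩; exact ⟨b, a⟩
    · rintro ⟨a, b⟩; exact ⟨b, a, b.trans h1.le⟩
  rw [h3, Real.volume_Ioc, sub_zero]
  -- The sublevel set is empty only if `t = 0`. Otherwise it is a closed half-line, and by
  -- continuity the distribution function equals `t` at its endpoint.
  rcases S.eq_empty_or_nonempty with he | hne
  · have : t = 0 := by
      refine le_antisymm (le_of_not_gt fun hpos => ?_) h0
      obtain ⟨s, hs⟩ := ((tendsto_cdf_atBot μ).eventually_lt_const hpos).exists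
      have : s ∈ S := hs.le
      rw [he] at this
      exact this
    rw [he, this]; simp
  · have hbdd : BddAbove S := by
      obtain ⟨b, hb⟩ := ((tendsto_cdf_atTop μ).eventually_const_lt h1).exists
      refine ⟨b, fun s hs => ?_⟩
      by_contra hlt
      push Not at hlt
      exact absurd (hs : cdf μ s ≤ t) (not_le.mpr (hb.trans_le (monotone_cdf μ hlt.le)))
    have hcl : IsClosed S := isClosed_Iic.preimage hc
    have hmem : sSup S ∈ S := hcl.csSup_mem hne hbdd
    have hSI : S = Set.Iic (sSup S) := by
      ext s
      refine ⟨fun hs => le_csSup hbdd hs, fun hs => ?_⟩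
      exact (monotone_cdf μ hs).trans hmem
    have hval : cdf μ (sSup S) = t := by
      refine le_antisymm hmem ?_
      have h4 : Tendsto (cdf μ) (𝓝[>] (sSup S)) (𝓝 (cdf μ (sSup S))) :=
        (hc.tendsto _).mono_left nhdsWithin_le_nhds
      refine ge_of_tendsto h4 ?_
      filter_upwards [self_mem_nhdsWithin] with s hs
      by_contra hlt
      push Not at hlt
      exact absurd (le_csSup hbdd (show s ∈ S from hlt.le)) (not_le.mpr hs)
    rw [hSI, ← ofReal_cdf, hval]

end IntegralTransform

/-! ### A translation invariant weight on the torus. -/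

section CircleVandermonde

/-- `θ ↦ sin² (π θ)` on the circle `ℝ / ℤ`. -/
def circleSinSq : UnitAddCircle → ℝ :=
  Function.Periodic.lift (f := fun t : ℝ => Real.sin (Real.pi * t) ^ 2) (c := 1) fun t => by
    simp [mul_add, Real.sin_add_pi]

theorem circleSinSq_coe (t : ℝ) : circleSinSq (t : UnitAddCircle) = Real.sin (Real.pi * t) ^ 2 :=
  rfl

theorem continuous_circleSinSq : Continuous circleSinSq :=
  Continuous.quotient_liftOn' (by fun_prop) _

/-- The squared modulus `∏_{i<j} sin² π (θⱼ - θᵢ)` of the Vandermonde-type product. -/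
def circleVandermonde {N : ℕ} (θ : Fin N → UnitAddCircle) : ℝ≥0∞ :=
  ENNReal.ofReal (∏ i : Fin N, ∏ j ∈ Finset.Ioi i, circleSinSq (θ j - θ i))

theorem continuous_circleVandermonde {N : ℕ} : Continuous (circleVandermonde (N := N)) := by
  refine ENNReal.continuous_ofReal.comp ?_
  refine continuous_finsetProd _ fun i _ => continuous_finsetProd _ fun j _ => ?_
  exact continuous_circleSinSq.comp (by fun_prop)

theorem circleVandermonde_add {N : ℕ} (θ : Fin N → UnitAddCircle) (a : UnitAddCircle) :
    circleVandermonde (fun i => θ i + a) = circleVandermonde θ := by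
  simp [circleVandermonde]

theorem circleSinSq_nonneg (θ : UnitAddCircle) : 0 ≤ circleSinSq θ := by
  induction θ using QuotientAddGroup.induction_on with
  | H t => exact sq_nonneg _

theorem circleSinSq_le_one (θ : UnitAddCircle) : circleSinSq θ ≤ 1 := by
  induction θ using QuotientAddGroup.induction_on with
  | H t => exact Real.sin_sq_le_one _

/-- The integral of the Vandermonde-type product over all variables but the first. -/
def circleConst (n : ℕ) : ℝ≥0∞ :=
  ∫⁻ η : Fin n → UnitAddCircle, circleVandermonde (Fin.cons 0 η : Fin (n + 1) → UnitAddCircle)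

/-- The weight sees only differences, so a common shift by `a` and invariance of Haar measure remove
the dependence on the first variable. This makes the density of the filler exact. -/
theorem lintegral_circleVandermonde_cons (n : ℕ) (a : UnitAddCircle) :
    ∫⁻ η : Fin n → UnitAddCircle, circleVandermonde (Fin.cons a η : Fin (n + 1) → UnitAddCircle)
      = circleConst n := by
  rw [circleConst, ← lintegral_add_right_eq_self _ (fun _ => a)]
  refine lintegral_congr fun η => ?_
  rw [← circleVandermonde_add (Fin.cons 0 η) a]
  congr 1
  ext i : 1
  refine Fin.cases ?_ (fun j => ?_) i <;> simp

theorem circleConst_ne_top (n : ℕ) : circleConst n ≠ ⊤ := by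
  refine ne_top_of_le_ne_top (b := 1) (by simp) ?_
  refine (lintegral_mono (g := fun _ => 1) fun η => ?_).trans (by
    simp [volume_pi, Measure.pi_univ])
  rw [circleVandermonde, ENNReal.ofReal_le_one]
  exact Finset.prod_le_one (fun i _ => Finset.prod_nonneg fun j _ => circleSinSq_nonneg _)
    fun i _ => Finset.prod_le_one (fun j _ => circleSinSq_nonneg _) fun j _ => circleSinSq_le_one _

theorem circleConst_ne_zero (n : ℕ) : circleConst n ≠ 0 := by
  have hcont : Continuous fun η : Fin n → UnitAddCircle =>
      circleVandermonde (Fin.cons 0 η : Fin (n + 1) → UnitAddCircle) := by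
    refine continuous_circleVandermonde.comp ?_
    exact continuous_const.finCons continuous_id
  intro h0
  rw [circleConst, lintegral_eq_zero_iff hcont.measurable] at h0
  have h1 := (Continuous.ae_eq_iff_eq _ hcont
    (continuous_const (y := (0 : ℝ≥0∞)))).mp h0
  -- Together with `0` these are `n + 1` equally spaced points, at which no factor vanishes.
  have h2 := congrFun h1 fun j => (((j : ℝ) + 1) / (n + 1) : ℝ)
  revert h2
  have hcons : (Fin.cons 0 fun j : Fin n => (((((j : ℝ) + 1) / (n + 1) : ℝ)) : UnitAddCircle))
      = fun i : Fin (n + 1) => ((((i : ℕ) : ℝ) / (n + 1) : ℝ) : UnitAddCircle) := by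
    ext i : 1
    refine Fin.cases ?_ (fun j => ?_) i <;> simp
  rw [hcons, circleVandermonde, ENNReal.ofReal_eq_zero]
  refine not_le.mpr (Finset.prod_pos fun i _ => Finset.prod_pos fun j hj => ?_)
  rw [← AddCircle.coe_sub, circleSinSq_coe]
  have hij : (i : ℕ) < j := Fin.lt_def.mp (Finset.mem_Ioi.mp hj)
  have hij' : ((i : ℕ) : ℝ) < ((j : ℕ) : ℝ) := by exact_mod_cast hij
  have hj' : ((j : ℕ) : ℝ) < n + 1 := by exact_mod_cast j.2
  have hn : (0 : ℝ) < n + 1 := by positivity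
  refine pow_pos (Real.sin_pos_of_pos_of_lt_pi ?_ ?_) 2
  · rw [← sub_div]
    exact mul_pos Real.pi_pos (div_pos (by linarith) hn)
  · rw [← sub_div]
    refine mul_lt_of_lt_one_right Real.pi_pos ((div_lt_one hn).mpr ?_)
    have : (0 : ℝ) ≤ ((i : ℕ) : ℝ) := by positivity
    linarith

end CircleVandermonde

/-! ### Mass of a slab. -/

section SlabMass

/-- The mass of `w²` in a slab is controlled by the width of the slab. -/
theorem HasDiffBound.slab_le {w : Space → ℝ} (hw : MemLp w 2 volume) {k : Fin 3} {C : ℝ≥0}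
    (h : HasDiffBound w (EuclideanSpace.single k 1) C) {a b : ℝ} (hab : a ≤ b) :
    ∫ x in {x : Space | a < x k ∧ x k ≤ b}, w x ^ 2
      ≤ 2 * C * (eLpNorm w 2 volume).toReal * (b - a) := by
  set e : Space := EuclideanSpace.single k 1
  set t := b - a
  have ht : 0 ≤ t := sub_nonneg.mpr hab
  have hcoord : Measurable fun x : Space => x k := by fun_prop
  let H : Set Space := {x | a < x k}
  have hH : MeasurableSet H := measurableSet_lt measurable_const hcoord
  let H' : Set Space := {x | b < x k}
  have hH' : MeasurableSet H' := measurableSet_lt measurable_const hcoord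
  have hi : Integrable fun x => w x ^ 2 := hw.integrable_sq
  have hw' := hw.comp_add_smul e t
  have hi' : Integrable fun x => w (x + t • e) ^ 2 := hw'.integrable_sq
  have split : ∫ x in H, w x ^ 2
      = (∫ x in {x : Space | a < x k ∧ x k ≤ b}, w x ^ 2) + ∫ x in H', w x ^ 2 := by
    rw [← setIntegral_union _ hH' hi.integrableOn hi.integrableOn]
    · congr 2
      ext x
      simp only [H, H', Set.mem_ofPred_eq, Set.mem_union]
      constructor
      · intro hx
        rcases le_or_gt (x k) b with h1 | h1
        · exact Or.inl ⟨hx, h1⟩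
        · exact Or.inr h1
      · rintro (hx | hx)
        · exact hx.1
        · exact hab.trans_lt hx
    · rw [Set.disjoint_left]
      rintro x ⟨-, h1⟩ h2
      exact absurd h1 (not_le.mpr h2)
  have shift : ∫ x in H', w x ^ 2 = ∫ x in H, w (x + t • e) ^ 2 := by
    rw [← integral_indicator hH, ← integral_indicator hH',
      ← integral_add_right_eq_self (μ := volume) (H'.indicator fun x => w x ^ 2) (t • e)]
    congr 1
    ext x
    simp only [Set.indicator_apply]
    have : x + t • e ∈ H' ↔ x ∈ H := by
      simp only [H, H', Set.mem_ofPred_eq, e, t]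
      simp
      constructor <;> intro <;> linarith
    simp only [this]
  have hd : MemLp (H.indicator fun x => w (x + t • e) - w x) 2 volume := (hw'.sub hw).indicator hH
  have hs : MemLp (fun x => w (x + t • e) + w x) 2 volume := hw'.add hw
  -- The slab is a difference of two half-spaces that are translates of each other. After shifting,
  -- the integrand is a difference of squares, to which Cauchy-Schwarz applies.
  have main : (∫ x in H, w x ^ 2) - ∫ x in H, w (x + t • e) ^ 2
      = -∫ x, inner ℝ ((H.indicator fun x => w (x + t • e) - w x) x) (w (x + t • e) + w x) := by
    rw [← integral_sub hi.integrableOn hi'.integrableOn, ← integral_indicator hH, ← integral_neg]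
    congr 1
    ext x
    simp only [Set.indicator_apply]
    split_ifs
    · simp only [RCLike.inner_apply, conj_trivial]; ring
    · simp
  have bound := abs_integral_inner_le hd hs
  have b1 : (eLpNorm (H.indicator fun x => w (x + t • e) - w x) 2 volume).toReal ≤ C * t := by
    have h2 := (eLpNorm_indicator_le (s := H) (fun x => w (x + t • e) - w x)).trans (h t)
    refine (ENNReal.toReal_mono (by finiteness) h2).trans_eq ?_
    rw [ENNReal.toReal_mul, toReal_enorm, Real.norm_of_nonneg ht]
    rfl
  have b2 : (eLpNorm (fun x => w (x + t • e) + w x) 2 volume).toReal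
      ≤ 2 * (eLpNorm w 2 volume).toReal := by
    have h2 : eLpNorm (fun x => w (x + t • e) + w x) 2 volume ≤ 2 * eLpNorm w 2 volume := by
      refine (eLpNorm_add_le hw'.1 hw.1 one_le_two).trans_eq ?_
      rw [eLpNorm_comp_add hw.1, two_mul]
    refine (ENNReal.toReal_mono (ENNReal.mul_ne_top (by simp) hw.2.ne) h2).trans_eq ?_
    simp
  have : ∫ x in {x : Space | a < x k ∧ x k ≤ b}, w x ^ 2
      = (∫ x in H, w x ^ 2) - ∫ x in H, w (x + t • e) ^ 2 := by
    rw [split, shift]; ring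
  rw [this, main]
  calc _ ≤ _ := (neg_le_abs _).trans bound
    _ ≤ (C * t) * (2 * (eLpNorm w 2 volume).toReal) := by gcongr
    _ = _ := by ring

end SlabMass

/-! ### Antisymmetric products of an odd function. -/

section Vandermonde

theorem MemH1.const_smul {N : ℕ} {u : Config N → ℂ} (hu : MemH1 u) (c : ℝ) :
    MemH1 fun x => c • u x := by
  rw [memH1_iff] at hu ⊢
  refine ⟨hu.1.const_smul c, fun e => ?_⟩
  obtain ⟨C, hC⟩ := hu.2 e
  refine ⟨‖c‖₊ * C, fun t => ?_⟩
  have e1 : (fun x => c • u (x + t • e) - c • u x) = c • fun x => u (x + t • e) - u x := by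
    ext x; simp [mul_sub]
  rw [e1, eLpNorm_const_smul, ENNReal.coe_mul, mul_assoc]
  exact mul_le_mul_right (hC t) _

theorem memH1_zero {N : ℕ} : MemH1 fun _ : Config N => (0 : ℂ) := by
  rw [memH1_iff]
  refine ⟨MemLp.zero', fun e => ⟨0, fun t => ?_⟩⟩
  simp

/-- The Vandermonde-type product `∏_{i<j} h (yⱼ - yᵢ)`. -/
def oddProd (h : ℝ → ℝ) {N : ℕ} (y : Fin N → ℝ) : ℝ :=
  ∏ i : Fin N, ∏ j ∈ Finset.Ioi i, h (y j - y i)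

variable {h : ℝ → ℝ} {N : ℕ}

theorem oddProd_perm (hodd : ∀ t, h (-t) = -h t) (σ : Equiv.Perm (Fin N)) (y : Fin N → ℝ) :
    oddProd h (fun i => y (σ i)) = (Equiv.Perm.sign σ : ℤ) * oddProd h y :=
  σ.prod_Ioi_comp_eq_sign_mul_prod (f := fun i j => h (y j - y i)) fun i j => by
    rw [← hodd, neg_sub]

theorem abs_oddProd_le_one (h1 : ∀ t, |h t| ≤ 1) (y : Fin N → ℝ) : |oddProd h y| ≤ 1 := by
  rw [oddProd, Finset.abs_prod]
  refine Finset.prod_le_one (fun i _ => abs_nonneg _) fun i _ => ?_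
  rw [Finset.abs_prod]
  exact Finset.prod_le_one (fun j _ => abs_nonneg _) fun j _ => h1 _

theorem abs_oddProd_le (h1 : ∀ t, |h t| ≤ 1) (y : Fin N → ℝ) {i j : Fin N} (hij : i < j) :
    |oddProd h y| ≤ |h (y j - y i)| := by
  rw [oddProd, Finset.abs_prod, ← Finset.mul_prod_erase _ _ (Finset.mem_univ i), Finset.abs_prod,
    ← Finset.mul_prod_erase _ _ (Finset.mem_Ioi.mpr hij), mul_assoc]
  refine mul_le_of_le_one_right (abs_nonneg _) (mul_le_one₀ ?_ ?_ ?_)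
  · exact Finset.prod_le_one (fun j _ => abs_nonneg _) fun j _ => h1 _
  · exact Finset.prod_nonneg fun _ _ => abs_nonneg _
  · refine Finset.prod_le_one (fun i _ => abs_nonneg _) fun i _ => ?_
    rw [Finset.abs_prod]
    exact Finset.prod_le_one (fun j _ => abs_nonneg _) fun j _ => h1 _

theorem exists_lipschitzWith_oddProd {K L : ℝ≥0} (hK : LipschitzWith K h) (h1 : ∀ t, |h t| ≤ 1)
    {G : Space → ℝ} (hG : LipschitzWith L G) :
    ∃ K', LipschitzWith K' fun x : Config N => oddProd h fun i => G (x i) := by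
  refine exists_lipschitzWith_prod Finset.univ
    (fun (i : Fin N) (x : Config N) => ∏ j ∈ Finset.Ioi i, h (G (x j) - G (x i))) ?_ ?_
  · intro i _ x
    rw [Finset.abs_prod]
    exact Finset.prod_le_one (fun j _ => abs_nonneg _) fun j _ => h1 _
  · intro i _
    refine exists_lipschitzWith_prod (Finset.Ioi i)
      (fun (j : Fin N) (x : Config N) => h (G (x j) - G (x i))) (fun j _ x => h1 _) fun j _ => ?_
    exact ⟨_, hK.comp ((hG.comp (LipschitzWith.eval j)).sub (hG.comp (LipschitzWith.eval i)))⟩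

end Vandermonde

/-! ### Transport of a density to the uniform measure on the circle. -/

section Transform

open ProbabilityTheory

theorem lipschitzWith_coord (k : Fin 3) : LipschitzWith 1 fun x : Space => x k := by
  refine LipschitzWith.of_dist_le_mul fun x y => ?_
  rw [NNReal.coe_one, one_mul, Real.dist_eq, dist_eq_norm, ← Real.norm_eq_abs]
  exact PiLp.norm_apply_le (x - y) k

theorem lipschitzWith_cdf {μ : Measure ℝ} [IsProbabilityMeasure μ] {K : ℝ≥0}
    (h : ∀ a b, a ≤ b → μ.real (Set.Ioc a b) ≤ K * (b - a)) : LipschitzWith K (cdf μ) := by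
  refine LipschitzWith.of_le_add_mul K fun x y => ?_
  rcases le_total x y with hxy | hxy
  · exact (monotone_cdf μ hxy).trans (le_add_of_nonneg_right (by positivity))
  · have h1 := h y x hxy
    rw [← Set.Iic_sdiff_Iic, measureReal_sdiff (Set.Iic_subset_Iic.mpr hxy) measurableSet_Iic,
      ← cdf_eq_real, ← cdf_eq_real] at h1
    rw [Real.dist_eq, abs_of_nonneg (sub_nonneg.mpr hxy)]
    linarith

/-- A Lipschitz function of the `k`-th coordinate that transports the density `w²`, normalized, to
the uniform distribution on the circle. -/
theorem exists_transport_circle {w : Space → ℝ} (hwm : Measurable w) (hw : MemLp w 2 volume)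
    (hw0 : eLpNorm w 2 volume ≠ 0) {k : Fin 3} {C : ℝ≥0}
    (h : HasDiffBound w (EuclideanSpace.single k 1) C) :
    ∃ G : Space → ℝ, LipschitzWith (2 * C / (eLpNorm w 2 volume).toNNReal) G ∧
      MeasurePreserving (fun x => (G x : UnitAddCircle))
        (volume.withDensity fun x => (eLpNorm w 2 volume ^ 2)⁻¹ * ‖w x‖ₑ ^ 2) volume := by
  set M := eLpNorm w 2 volume with hM
  have hMt : M ≠ ⊤ := hw.2.ne
  have hMr : 0 < M.toReal := ENNReal.toReal_pos hw0 hMt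
  set ν := (volume : Measure Space).withDensity fun x => (M ^ 2)⁻¹ * ‖w x‖ₑ ^ 2 with hν
  have hfm : Measurable fun x => ‖w x‖ₑ ^ 2 := hwm.enorm.pow_const 2
  have hprob : IsProbabilityMeasure ν := by
    refine ⟨?_⟩
    rw [hν, withDensity_apply _ MeasurableSet.univ, Measure.restrict_univ,
      lintegral_const_mul _ hfm, ← eLpNorm_two_sq]
    exact ENNReal.inv_mul_cancel (pow_ne_zero 2 hw0) (ENNReal.pow_ne_top hMt)
  have hcoord : Measurable fun x : Space => x k := by fun_prop
  set ν₁ := ν.map fun x : Space => x k with hν₁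
  have hprob₁ : IsProbabilityMeasure ν₁ := Measure.isProbabilityMeasure_map hcoord.aemeasurable
  -- The slab bound `2 C M (b - a)` is divided by the total mass `M ^ 2`.
  have hslab : ∀ a b, a ≤ b → ν₁.real (Set.Ioc a b) ≤ (2 * C / M.toNNReal : ℝ≥0) * (b - a) := by
    intro a b hab
    have e1 : ν₁ (Set.Ioc a b)
        = (M ^ 2)⁻¹ * ENNReal.ofReal (∫ x in {x : Space | a < x k ∧ x k ≤ b}, w x ^ 2) := by
      rw [hν₁, Measure.map_apply hcoord measurableSet_Ioc, hν,
        withDensity_apply _ (hcoord measurableSet_Ioc), lintegral_const_mul _ hfm,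
        ofReal_integral_eq_lintegral_ofReal hw.integrable_sq.integrableOn
          (.of_forall fun x => sq_nonneg _)]
      congr 1
      refine lintegral_congr fun x => ?_
      rw [← Real.enorm_of_nonneg (sq_nonneg (w x)), enorm_pow]
    rw [measureReal_def, e1, ENNReal.toReal_mul, ENNReal.toReal_inv, ENNReal.toReal_pow,
      ENNReal.toReal_ofReal (integral_nonneg fun x => sq_nonneg _)]
    refine (mul_le_mul_of_nonneg_left (h.slab_le hw hab) (by positivity)).trans_eq ?_
    push_cast
    change _ = 2 * (C : ℝ) / M.toReal * (b - a)
    rw [← hM]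
    field_simp
  have hL := lipschitzWith_cdf hslab
  refine ⟨fun x => cdf ν₁ (x k), ?_, ?_⟩
  · simpa [Function.comp_def] using hL.comp (lipschitzWith_coord k)
  · have m1 : MeasurePreserving (fun x : Space => x k) ν ν₁ := ⟨hcoord, rfl⟩
    have m2 : MeasurePreserving (cdf ν₁) ν₁ (volume.restrict (Set.Ioc 0 1)) :=
      ⟨hL.continuous.measurable, map_cdf_eq ν₁ hL.continuous⟩
    have m3 : MeasurePreserving (fun t : ℝ => (t : UnitAddCircle))
        (volume.restrict (Set.Ioc 0 1)) volume := by
      simpa using AddCircle.measurePreserving_mk 1 0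
    exact m3.comp (m2.comp m1)

end Transform

/-! ### An antisymmetric function of prescribed density and small interaction. -/

section Filler

/-- The constant in `exists_antisymm_of_sqrtDensity`. -/
def fillerConst (n : ℕ) : ℝ≥0∞ :=
  2 * (n + 1 : ℕ) * ENNReal.ofReal Real.pi / circleConst n

theorem fillerConst_ne_top (n : ℕ) : fillerConst n ≠ ⊤ :=
  ENNReal.div_ne_top (by finiteness) (circleConst_ne_zero n)

/-- `sin (π t)` changes sign under `t ↦ t + 1`, so only the squared product descends to the circle;
the product itself, being odd in each difference, supplies antisymmetry. -/
theorem sin_oddProd_sq_eq {N : ℕ} (G : Space → ℝ) (x : Config N) :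
    ‖oddProd (fun t => Real.sin (Real.pi * t)) fun i => G (x i)‖ₑ ^ 2
      = circleVandermonde fun i => (G (x i) : UnitAddCircle) := by
  rw [circleVandermonde, ← enorm_pow, Real.enorm_eq_ofReal (sq_nonneg _), oddProd,
    ← Finset.prod_pow]
  congr 1
  refine Finset.prod_congr rfl fun i _ => ?_
  rw [← Finset.prod_pow]
  refine Finset.prod_congr rfl fun j _ => ?_
  rw [← AddCircle.coe_sub, circleSinSq_coe]

/-- Repulsion: the Vandermonde-type product compensates the Coulomb singularity. -/
theorem inv_mul_sin_oddProd_sq_le {N : ℕ} {G : Space → ℝ} {K : ℝ≥0} (hG : LipschitzWith K G)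
    (x : Config N) {i j : Fin N} (hij : i < j) :
    ‖x i - x j‖ₑ⁻¹ * ‖oddProd (fun t => Real.sin (Real.pi * t)) fun i => G (x i)‖ₑ ^ 2
      ≤ ENNReal.ofReal Real.pi * K := by
  rw [mul_comm, ← div_eq_mul_inv]
  refine ENNReal.div_le_of_le_mul ?_
  set S := oddProd (fun t => Real.sin (Real.pi * t)) fun i => G (x i)
  have h1 : ∀ t : ℝ, |Real.sin (Real.pi * t)| ≤ 1 := fun t => Real.abs_sin_le_one _
  have hS1 : |S| ≤ 1 := abs_oddProd_le_one h1 _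
  have hS2 : |S| ≤ Real.pi * (K * ‖x i - x j‖) := by
    refine (abs_oddProd_le h1 (fun i => G (x i)) hij).trans (Real.abs_sin_le_abs.trans ?_)
    rw [abs_mul, abs_of_pos Real.pi_pos]
    refine mul_le_mul_of_nonneg_left ?_ Real.pi_pos.le
    rw [norm_sub_rev]
    exact hG.norm_sub_le _ _
  -- One factor `|S|` cancels the singularity; the other is only bounded by `1`.
  have hS3 : S ^ 2 ≤ Real.pi * (K * ‖x i - x j‖) := by
    rw [← sq_abs, sq]
    exact (mul_le_of_le_one_left (abs_nonneg _) hS1).trans hS2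
  rw [← enorm_pow, Real.enorm_eq_ofReal (sq_nonneg _)]
  refine (ENNReal.ofReal_le_ofReal hS3).trans_eq ?_
  rw [ENNReal.ofReal_mul Real.pi_pos.le, ENNReal.ofReal_mul (NNReal.coe_nonneg K),
    ENNReal.ofReal_coe_nnreal, ofReal_norm, mul_assoc]

/-- Every density with square root in `H¹` is the density of an antisymmetric `H¹` wavefunction
whose interaction energy is controlled by the derivative in a single direction. -/
theorem exists_antisymm_of_sqrtDensity (n : ℕ) {w : Space → ℝ} (hw : MemLp w 2 volume)
    (hH : ∀ e, ∃ C, HasDiffBound w e C) {k : Fin 3} {C : ℝ≥0}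
    (h : HasDiffBound w (EuclideanSpace.single k 1) C) :
    ∃ Φ : Config (n + 1) → ℂ, MemH1 Φ ∧
      (∀ (σ : Equiv.Perm (Fin (n + 1))) (x : Config (n + 1)),
        Φ (fun i => x (σ i)) = ((Equiv.Perm.sign σ : ℤ) : ℂ) * Φ x) ∧
      (∀ᵐ x, oneBodyDensity Φ x = ENNReal.ofReal (w x ^ 2)) ∧
      interactionEnergy Φ ≤ fillerConst n * (C * eLpNorm w 2 volume) := by
  wlog hwm : Measurable w generalizing w
  · have hae := hw.1.ae_eq_mk
    obtain ⟨Φ, h1, h2, h3, h4⟩ := this (w := hw.1.mk w) ((memLp_congr_ae hae).mp hw)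
      (fun e => (hH e).imp fun C hC => hC.congr hae) (h.congr hae)
      hw.1.stronglyMeasurable_mk.measurable
    refine ⟨Φ, h1, h2, ?_, ?_⟩
    · filter_upwards [h3, hae] with x hx hx'
      rw [hx, hx']
    · rwa [eLpNorm_congr_ae hae]
  by_cases hw0 : eLpNorm w 2 volume = 0
  · refine ⟨fun _ => 0, memH1_zero, fun σ x => by simp, ?_, by simp [interactionEnergy]⟩
    rw [eLpNorm_eq_zero_iff hw.1 two_ne_zero] at hw0
    filter_upwards [hw0] with x hx
    simp [oneBodyDensity, hx]
  obtain ⟨G, hG, hmp⟩ := exists_transport_circle hwm hw hw0 h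
  set M := eLpNorm w 2 volume with hM
  have hMt : M ≠ ⊤ := hw.2.ne
  set s : ℝ → ℝ := fun t => Real.sin (Real.pi * t) with hs
  have hs1 : ∀ t, |s t| ≤ 1 := fun t => Real.abs_sin_le_one _
  have hsl : LipschitzWith (1 * ‖Real.pi‖₊) s :=
    Real.lipschitzWith_sin.comp (lipschitzWith_smul Real.pi)
  obtain ⟨L, hL⟩ := exists_lipschitzWith_oddProd (N := n + 1) hsl hs1 hG
  -- `D` is the factor by which the unnormalized density exceeds `w²`: the particle number times the
  -- integral over the other `n` particles.
  set D : ℝ≥0∞ := (n + 1 : ℕ) * ((M ^ 2) ^ n * circleConst n) with hD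
  have hD0 : D ≠ 0 := mul_ne_zero (by simp)
    (mul_ne_zero (pow_ne_zero _ (pow_ne_zero _ hw0)) (circleConst_ne_zero n))
  have hDt : D ≠ ⊤ := ENNReal.mul_ne_top (by finiteness)
    (ENNReal.mul_ne_top (ENNReal.pow_ne_top (ENNReal.pow_ne_top hMt)) (circleConst_ne_top n))
  let c : ℝ := √(D.toReal⁻¹)
  have hc : ‖c‖ₑ ^ 2 = D⁻¹ := by
    rw [← enorm_pow, Real.sq_sqrt (by positivity), Real.enorm_eq_ofReal (by positivity),
      ← ENNReal.toReal_inv, ENNReal.ofReal_toReal (ENNReal.inv_ne_top.mpr hD0)]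
  let W : Config (n + 1) → ℂ := fun x => ((∏ j, w (x j) : ℝ) : ℂ)
  let S : Config (n + 1) → ℝ := fun x => oddProd s fun i => G (x i)
  let Φ : Config (n + 1) → ℂ := fun x => c • (S x • W x)
  have hW : MemH1 W := by
    rw [memH1_iff]
    refine ⟨(memLp_tensor hw).ofReal, fun e => ?_⟩
    obtain ⟨C', hC'⟩ := HasDiffBound.tensor hw hH e
    exact ⟨C', hC'.ofReal⟩
  have hnorm : ∀ x, ‖Φ x‖ₑ ^ 2
      = D⁻¹ * ((∏ j, ‖w (x j)‖ₑ ^ 2) * circleVandermonde fun i => (G (x i) : UnitAddCircle)) := by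
    intro x
    simp only [Φ, enorm_smul, mul_pow, hc]
    rw [sin_oddProd_sq_eq, mul_comm (circleVandermonde _)]
    congr 2
    rw [Finset.prod_pow, ← enorm_finsetProd]
    simp [W, enorm, nnnorm]
  have hwsq : Measurable fun x => ‖w x‖ₑ ^ 2 := hwm.enorm.pow_const 2
  refine ⟨Φ, (hW.lipschitz_smul hL fun x => abs_oddProd_le_one hs1 _).const_smul c, ?_, ?_, ?_⟩
  · intro σ x
    simp only [Φ, S, W]
    rw [oddProd_perm (fun t => by simp [hs]) σ fun i => G (x i), Equiv.prod_comp σ fun j => w (x j)]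
    simp only [Complex.real_smul]
    push_cast
    ring
  · refine .of_forall fun a => ?_
    rw [oneBodyDensity]
    simp only [hnorm, Fin.prod_univ_succ, Fin.cons_zero, Fin.cons_succ]
    have hcirc : ∀ y : Config n, (fun i => (G ((Fin.cons a y : Config (n + 1)) i) : UnitAddCircle))
        = Fin.cons (G a : UnitAddCircle) fun i => (G (y i) : UnitAddCircle) := by
      intro y
      ext i : 1
      refine Fin.cases ?_ (fun j => ?_) i <;> simp
    have hgm : Measurable fun η : Fin n → UnitAddCircle =>
        circleVandermonde (Fin.cons (G a : UnitAddCircle) η : Fin (n + 1) → UnitAddCircle) :=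
      continuous_circleVandermonde.measurable.comp (measurable_finCons.comp measurable_prodMk_left)
    have hΘ : Measurable fun y : Config n => fun i => (G (y i) : UnitAddCircle) :=
      measurable_pi_iff.mpr fun i => hmp.measurable.comp (measurable_pi_apply i)
    -- Normalizing each `w²` gives the factor `(M ^ 2) ^ n`; then `G` carries the remaining
    -- variables to independent uniform points on the circle.
    have key : ∫⁻ y : Config n, (∏ j, ‖w (y j)‖ₑ ^ 2) * circleVandermonde
          (Fin.cons (G a : UnitAddCircle) fun i => (G (y i) : UnitAddCircle) :
            Fin (n + 1) → UnitAddCircle)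
        = (M ^ 2) ^ n * circleConst n := by
      have hsig : SigmaFinite
          (volume.withDensity fun x : Space => (M ^ 2)⁻¹ * ‖w x‖ₑ ^ 2) := by
        have : IsFiniteMeasure (volume.withDensity fun x : Space => (M ^ 2)⁻¹ * ‖w x‖ₑ ^ 2) := by
          refine ⟨?_⟩
          rw [← Set.preimage_univ (f := fun x => (G x : UnitAddCircle)),
            hmp.measure_preimage MeasurableSet.univ.nullMeasurableSet]
          simp
        infer_instance
      have h5 := lintegral_pi_prod_mul (volume : Measure Space) (n := n)
        (f := fun x => (M ^ 2)⁻¹ * ‖w x‖ₑ ^ 2) (hwsq.const_mul _) (hgm.comp hΘ)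
      have h6 := (measurePreserving_pi
        (fun _ : Fin n => volume.withDensity fun x : Space => (M ^ 2)⁻¹ * ‖w x‖ₑ ^ 2)
        (fun _ : Fin n => (volume : Measure UnitAddCircle)) fun _ => hmp).lintegral_comp hgm
      have h7 := lintegral_circleVandermonde_cons n (G a : UnitAddCircle)
      have h8 := (h5.trans h6).trans h7
      rw [← h8]
      simp only [Function.comp_def,
        Finset.prod_mul_distrib, Finset.prod_const, Finset.card_univ, Fintype.card_fin,
        mul_assoc]
      rw [lintegral_const_mul' _ _ (by
          exact ENNReal.pow_ne_top (ENNReal.inv_ne_top.mpr (pow_ne_zero 2 hw0))), ← mul_assoc,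
        ← mul_pow, ENNReal.mul_inv_cancel (pow_ne_zero 2 hw0) (ENNReal.pow_ne_top hMt), one_pow,
        one_mul]
      rfl
    simp only [hcirc, mul_assoc]
    rw [lintegral_const_mul' _ _ (ENNReal.inv_ne_top.mpr hD0),
      lintegral_const_mul' _ _ (by finiteness), key]
    have : ((n + 1 : ℕ) : ℝ≥0∞) * (D⁻¹ * (‖w a‖ₑ ^ 2 * ((M ^ 2) ^ n * circleConst n)))
        = (D⁻¹ * D) * ‖w a‖ₑ ^ 2 := by rw [hD]; ring
    rw [this, ENNReal.inv_mul_cancel hD0 hDt, one_mul, ← enorm_pow,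
      Real.enorm_eq_ofReal (sq_nonneg _)]
  · set K : ℝ≥0 := 2 * C / M.toNNReal with hK
    have hpt : ∀ x : Config (n + 1), ∑ i : Fin (n + 1), ∑ j ∈ Finset.Ioi i,
        ‖x i - x j‖ₑ⁻¹ * ‖Φ x‖ₑ ^ 2 ≤ ((n + 1 : ℕ) : ℝ≥0∞) * (n + 1 : ℕ) *
          (ENNReal.ofReal Real.pi * K) * D⁻¹ * ‖∏ j, w (x j)‖ₑ ^ 2 := by
      intro x
      have h5 : ∀ i : Fin (n + 1), ∀ j ∈ Finset.Ioi i, ‖x i - x j‖ₑ⁻¹ * ‖Φ x‖ₑ ^ 2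
          ≤ (ENNReal.ofReal Real.pi * K) * D⁻¹ * ‖∏ j, w (x j)‖ₑ ^ 2 := by
        intro i j hij
        have h6 := inv_mul_sin_oddProd_sq_le hG x (Finset.mem_Ioi.mp hij)
        rw [sin_oddProd_sq_eq] at h6
        rw [hnorm, enorm_finsetProd, Finset.prod_pow]
        calc _ = (‖x i - x j‖ₑ⁻¹ * circleVandermonde fun i => (G (x i) : UnitAddCircle))
              * D⁻¹ * (∏ j, ‖w (x j)‖ₑ) ^ 2 := by ring
          _ ≤ _ := by gcongr
      have h7 : ∀ i : Fin (n + 1), ∑ j ∈ Finset.Ioi i, ‖x i - x j‖ₑ⁻¹ * ‖Φ x‖ₑ ^ 2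
          ≤ (n + 1 : ℕ) * ((ENNReal.ofReal Real.pi * K) * D⁻¹ * ‖∏ j, w (x j)‖ₑ ^ 2) := by
        intro i
        refine (Finset.sum_le_card_nsmul _ _ _ (h5 i)).trans ?_
        rw [nsmul_eq_mul]
        gcongr
        simpa using Finset.card_le_univ (Finset.Ioi i)
      refine (Finset.sum_le_card_nsmul _ _ _ fun i _ => h7 i).trans_eq ?_
      rw [nsmul_eq_mul, Finset.card_univ, Fintype.card_fin]
      ring
    refine (lintegral_mono hpt).trans ?_
    have hfin : ((n + 1 : ℕ) : ℝ≥0∞) * (n + 1 : ℕ) * (ENNReal.ofReal Real.pi * K) * D⁻¹ ≠ ⊤ :=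
      ENNReal.mul_ne_top (by finiteness) (ENNReal.inv_ne_top.mpr hD0)
    rw [lintegral_const_mul' _ _ hfin, lintegral_tensor hw.1, ← hM]
    -- The Lipschitz constant of `G` grows like `1 / M`, which leaves one of the two surviving
    -- powers of `M`: the energy bound is linear in the norm.
    have hKM : (K : ℝ≥0∞) * M = 2 * C := by
      rw [hK, ENNReal.coe_div (by simp [ENNReal.toNNReal_eq_zero_iff, hw0, hMt]),
        ENNReal.coe_toNNReal hMt, ENNReal.div_mul_cancel hw0 hMt]
      simp
    have hN0 : ((n + 1 : ℕ) : ℝ≥0∞) ≠ 0 := by simp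
    have hNt : ((n + 1 : ℕ) : ℝ≥0∞) ≠ ⊤ := by finiteness
    have hP0 : (M ^ 2) ^ n ≠ 0 := pow_ne_zero _ (pow_ne_zero _ hw0)
    have hPt : (M ^ 2) ^ n ≠ ⊤ := ENNReal.pow_ne_top (ENNReal.pow_ne_top hMt)
    have hDi : D⁻¹ = ((n + 1 : ℕ) : ℝ≥0∞)⁻¹ * (((M ^ 2) ^ n)⁻¹ * (circleConst n)⁻¹) := by
      rw [hD, ENNReal.mul_inv (Or.inl hN0) (Or.inl hNt), ENNReal.mul_inv (Or.inl hP0) (Or.inl hPt)]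
    rw [hDi, fillerConst, div_eq_mul_inv, pow_succ (M ^ 2) n]
    refine le_of_eq ?_
    calc _ = (((n + 1 : ℕ) : ℝ≥0∞) * ((n + 1 : ℕ) : ℝ≥0∞)⁻¹) * (((M ^ 2) ^ n) * ((M ^ 2) ^ n)⁻¹)
          * ((n + 1 : ℕ) * ENNReal.ofReal Real.pi * (circleConst n)⁻¹ * ((K * M) * M)) := by ring
      _ = _ := by
        rw [ENNReal.mul_inv_cancel hN0 hNt, ENNReal.mul_inv_cancel hP0 hPt, hKM]
        ring

end Filler

/-! ### The limit of vanishing kinetic coupling. -/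

section Limits

/-- The lower bound is nonnegativity of the `T` term. For the upper bound, fix a near-minimizer of
`V`; its finite `T` is killed as `α → 0`. -/
theorem tendsto_iInf_mul_add {ι : Type*} {P Q : ι → Prop} {T V : ι → ℝ≥0∞}
    (hT : ∀ i, P i → T i ≠ ⊤) :
    Tendsto (fun α : ℝ => ⨅ (i) (_ : P i) (_ : Q i), ENNReal.ofReal α * T i + V i) (𝓝[>] 0)
      (𝓝 (⨅ (i) (_ : P i) (_ : Q i), V i)) := by
  refine tendsto_order.mpr ⟨fun a ha => ?_, fun b hb => ?_⟩
  · refine .of_forall fun α => ha.trans_le ?_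
    gcongr with i hP hQ
    exact le_add_self
  · simp only [iInf_lt_iff] at hb
    obtain ⟨i, hP, hQ, hi⟩ := hb
    have h1 : Tendsto (fun α : ℝ => ENNReal.ofReal α * T i + V i) (𝓝[>] 0)
        (𝓝 (ENNReal.ofReal 0 * T i + V i)) := by
      refine Tendsto.add ?_ tendsto_const_nhds
      refine ENNReal.Tendsto.mul_const ?_ (Or.inr (hT i hP))
      exact (ENNReal.continuous_ofReal.tendsto 0).mono_left nhdsWithin_le_nhds
    rw [ENNReal.ofReal_zero, zero_mul, zero_add] at h1
    filter_upwards [h1.eventually_lt_const hi] with α hα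
    exact (iInf_le_of_le i (iInf₂_le hP hQ)).trans_lt hα

theorem kineticEnergy_ne_top {N : ℕ} {Φ : Config N → ℂ} (hΦ : MemH1 Φ) :
    kineticEnergy Φ ≠ ⊤ := by
  have hw : ∀ e, MemLp (weakDeriv Φ e) 2 volume := fun e => by
    rw [weakDeriv, dif_pos (hΦ.2 e)]
    exact (hΦ.2 e).choose_spec.1
  have hm : ∀ e, AEMeasurable (fun x => ‖weakDeriv Φ e x‖ₑ ^ 2) volume := fun e =>
    (hw e).1.enorm.pow_const 2
  rw [kineticEnergy, lintegral_finsetSum' _ fun i _ =>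
    Finset.aemeasurable_fun_sum _ fun k _ => hm (coordVec N i k)]
  refine ENNReal.sum_ne_top.mpr fun i _ => ?_
  rw [lintegral_finsetSum' _ fun k _ => hm (coordVec N i k)]
  refine ENNReal.sum_ne_top.mpr fun k _ => ?_
  rw [← eLpNorm_two_sq]
  exact ENNReal.pow_ne_top (hw _).2.ne

end Limits

/-! ### From fermions to bosons. -/

section Bosonization

theorem measurable_inv_dist {N : ℕ} (i j : Fin N) :
    Measurable fun x : Config N => ‖x i - x j‖ₑ⁻¹ :=
  (((measurable_pi_apply i).sub (measurable_pi_apply j)).enorm).inv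

theorem aestronglyMeasurable_configCons {n : ℕ} {Φ : Config (n + 1) → ℂ}
    (h : AEStronglyMeasurable Φ volume) :
    ∀ᵐ x : Space, AEStronglyMeasurable (fun y : Config n => Φ (Fin.cons x y)) volume := by
  have h1 : AEStronglyMeasurable (fun p : Space × Config n => Φ (Fin.cons p.1 p.2))
    (volume.prod volume) := h.comp_measurePreserving measurePreserving_configCons
  exact h1.prodMk_left

/-- The square root of a sum of squared moduli: density and interaction energy are additive. -/
theorem oneBodyDensity_eq_sum {ι : Type*} [Fintype ι] {n : ℕ} {Φ : Config (n + 1) → ℂ}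
    {u : ι → Config (n + 1) → ℂ} (hu : ∀ s, AEStronglyMeasurable (u s) volume)
    (h : ∀ x, ‖Φ x‖ₑ ^ 2 = ∑ s, ‖u s x‖ₑ ^ 2) :
    ∀ᵐ x, oneBodyDensity Φ x = ∑ s, oneBodyDensity (u s) x := by
  filter_upwards [ae_all_iff.mpr fun s => aestronglyMeasurable_configCons (hu s)] with x hx
  simp only [oneBodyDensity, h]
  rw [lintegral_finsetSum' _ fun s _ => (hx s).enorm.pow_const 2, Finset.mul_sum]

theorem interactionEnergy_eq_sum {ι : Type*} [Fintype ι] {N : ℕ} {Φ : Config N → ℂ}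
    {u : ι → Config N → ℂ} (hu : ∀ s, AEStronglyMeasurable (u s) volume)
    (h : ∀ x, ‖Φ x‖ₑ ^ 2 = ∑ s, ‖u s x‖ₑ ^ 2) :
    interactionEnergy Φ = ∑ s, interactionEnergy (u s) := by
  simp only [interactionEnergy]
  have hm : ∀ s, AEMeasurable (fun x : Config N => ∑ i : Fin N, ∑ j ∈ Finset.Ioi i,
      ‖x i - x j‖ₑ⁻¹ * ‖u s x‖ₑ ^ 2) volume := fun s =>
    Finset.aemeasurable_fun_sum _ fun i _ => Finset.aemeasurable_fun_sum _ fun j _ =>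
      (measurable_inv_dist i j).aemeasurable.mul ((hu s).enorm.pow_const 2)
  rw [← lintegral_finsetSum' _ fun s _ => hm s]
  refine lintegral_congr fun x => ?_
  simp only [h, Finset.mul_sum]
  exact (Finset.sum_congr rfl fun i _ => Finset.sum_comm).trans Finset.sum_comm

theorem exists_bosonic_of_fermionic {n : ℕ} {ρ : Space → ℝ}
    {Ψ : (Fin (n + 1) → Space × ZMod 2) → ℂ} (hΨ : IsFermionic Ψ) (hρ : FermionicRepresents Ψ ρ) :
    ∃ Φ : Config (n + 1) → ℂ, IsBosonic Φ ∧ BosonicRepresents Φ ρ ∧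
      interactionEnergy Φ = ∑ s : Fin (n + 1) → ZMod 2, interactionEnergy (spinComponent Ψ s) := by
  let Φ : Config (n + 1) → ℂ := fun x => ((√(∑ s, ‖spinComponent Ψ s x‖ ^ 2) : ℝ) : ℂ)
  have hmeas : ∀ s, AEStronglyMeasurable (spinComponent Ψ s) volume := fun s => (hΨ.memH1 s).1.1
  have hsq : ∀ x, ‖Φ x‖ₑ ^ 2 = ∑ s, ‖spinComponent Ψ s x‖ₑ ^ 2 := by
    intro x
    simp only [← ofReal_norm]
    simp_rw [← ENNReal.ofReal_pow (norm_nonneg _)]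
    rw [← ENNReal.ofReal_sum_of_nonneg fun s _ => sq_nonneg _, Complex.norm_real, Real.norm_eq_abs,
      sq_abs, Real.sq_sqrt (Finset.sum_nonneg fun s _ => sq_nonneg _)]
  have hint : ∫⁻ x, ‖Φ x‖ₑ ^ 2 = ∑ s, ∫⁻ x, ‖spinComponent Ψ s x‖ₑ ^ 2 := by
    simp only [hsq]
    exact lintegral_finsetSum' _ fun s _ => (hmeas s).enorm.pow_const 2
  have hΦm : AEStronglyMeasurable Φ volume := by
    refine Complex.continuous_ofReal.comp_aestronglyMeasurable ?_
    refine Real.continuous_sqrt.comp_aestronglyMeasurable ?_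
    exact Finset.aestronglyMeasurable_fun_sum _ fun s _ => (hmeas s).norm.pow 2
  refine ⟨Φ, ⟨?_, fun σ => ?_, hint.trans hΨ.norm_eq_one⟩, ?_, interactionEnergy_eq_sum hmeas hsq⟩
  · rw [memH1_iff]
    refine ⟨⟨hΦm, lt_top_iff_ne_top.mpr fun h' => ?_⟩, fun e => ?_⟩
    · have h1 := hint.trans hΨ.norm_eq_one
      rw [← eLpNorm_two_sq, h'] at h1
      simp at h1
    · choose C hC using fun s => (memH1_iff.mp (hΨ.memH1 s)).2 e
      exact ⟨_, HasDiffBound.sqrt_sum_sq hC hmeas⟩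
  · filter_upwards [ae_all_iff.mpr fun s => hΨ.antisymm σ s] with x hx
    simp only [Φ]
    congr 2
    -- Reindexing spins by `s ↦ s ∘ σ` turns the permutation of positions into a joint permutation,
    -- which changes each component only by a sign.
    rw [← Equiv.sum_comp (Equiv.arrowCongr σ.symm (Equiv.refl (ZMod 2)))]
    refine Finset.sum_congr rfl fun s _ => ?_
    congr 1
    have h1 := congrArg norm (hx s)
    rw [norm_mul] at h1
    have h2 : ‖(((Equiv.Perm.sign σ : ℤ)) : ℂ)‖ = 1 := by
      rcases Int.units_eq_one_or (Equiv.Perm.sign σ) with h | h <;> simp [h]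
    rw [h2, one_mul] at h1
    exact h1
  · filter_upwards [oneBodyDensity_eq_sum hmeas hsq, hρ] with x h1 h2
    rw [h1, h2]

end Bosonization

/-! ### Superposition of two opposite spin polarizations. -/

section SpinPolarized

/-- The wavefunction that equals `Φ₁` if all spins are `0`, `Φ₂` if all spins are `1`, and vanishes
otherwise. -/
def spinPolarized {N : ℕ} (Φ₁ Φ₂ : Config N → ℂ) (z : Fin N → Space × ZMod 2) : ℂ :=
  if ∀ i, (z i).2 = 0 then Φ₁ fun i => (z i).1
  else if ∀ i, (z i).2 = 1 then Φ₂ fun i => (z i).1 else 0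

variable {n : ℕ} {Φ₁ Φ₂ : Config (n + 1) → ℂ}

theorem spinComponent_spinPolarized_zero :
    spinComponent (spinPolarized Φ₁ Φ₂) (fun _ => 0) = Φ₁ := by
  ext x
  simp [spinComponent, spinPolarized]

theorem spinComponent_spinPolarized_one :
    spinComponent (spinPolarized Φ₁ Φ₂) (fun _ => 1) = Φ₂ := by
  ext x
  simp [spinComponent, spinPolarized]

theorem spinComponent_spinPolarized_of_ne {s : Fin (n + 1) → ZMod 2} (h0 : s ≠ fun _ => 0)
    (h1 : s ≠ fun _ => 1) : spinComponent (spinPolarized Φ₁ Φ₂) s = fun _ => 0 := by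
  ext x
  have h0' : ¬∀ i, s i = 0 := fun h => h0 (funext h)
  have h1' : ¬∀ i, s i = 1 := fun h => h1 (funext h)
  simp only [spinComponent, spinPolarized, if_neg h0', if_neg h1']

theorem sum_spinComponent_spinPolarized (T : (Config (n + 1) → ℂ) → ℝ≥0∞) (hT : T (fun _ => 0) = 0) :
    ∑ s : Fin (n + 1) → ZMod 2, T (spinComponent (spinPolarized Φ₁ Φ₂) s) = T Φ₁ + T Φ₂ := by
  rw [Fintype.sum_eq_add (fun _ => 0) (fun _ => 1)]
  · rw [spinComponent_spinPolarized_zero, spinComponent_spinPolarized_one]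
  · exact fun h => zero_ne_one (congrFun h 0)
  · rintro s ⟨h0, h1⟩
    rw [spinComponent_spinPolarized_of_ne h0 h1, hT]

theorem IsDensity.lintegral_eq {N : ℕ} {ρ : Space → ℝ} (hρ : IsDensity (N + 1) ρ) :
    ∫⁻ x, ENNReal.ofReal (ρ x) = (N + 1 : ℕ) := by
  have hi : Integrable ρ := by
    by_contra h
    have := hρ.integral_eq
    rw [integral_undef h] at this
    exact absurd this.symm (by positivity)
  rw [← ofReal_integral_eq_lintegral_ofReal hi hρ.nonneg, hρ.integral_eq, ENNReal.ofReal_natCast]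

/-- Constant spin configurations are fixed by permutations, so antisymmetry can be checked on each
spatial part. Normalization follows by integrating the density identity. -/
theorem isFermionic_spinPolarized {ρ : Space → ℝ} (hρ : IsDensity (n + 1) ρ) (h₁ : MemH1 Φ₁)
    (h₂ : MemH1 Φ₂)
    (a₁ : ∀ σ : Equiv.Perm (Fin (n + 1)), ∀ᵐ x : Config (n + 1),
      Φ₁ (fun i => x (σ i)) = ((Equiv.Perm.sign σ : ℤ) : ℂ) * Φ₁ x)
    (a₂ : ∀ σ : Equiv.Perm (Fin (n + 1)), ∀ᵐ x : Config (n + 1),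
      Φ₂ (fun i => x (σ i)) = ((Equiv.Perm.sign σ : ℤ) : ℂ) * Φ₂ x)
    (hd : ∀ᵐ x, oneBodyDensity Φ₁ x + oneBodyDensity Φ₂ x = ENNReal.ofReal (ρ x)) :
    IsFermionic (spinPolarized Φ₁ Φ₂) ∧ FermionicRepresents (spinPolarized Φ₁ Φ₂) ρ := by
  refine ⟨⟨fun s => ?_, fun σ s => ?_, ?_⟩, ?_⟩
  · by_cases h0 : s = fun _ => 0
    · rw [h0, spinComponent_spinPolarized_zero]; exact h₁
    by_cases h1 : s = fun _ => 1
    · rw [h1, spinComponent_spinPolarized_one]; exact h₂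
    rw [spinComponent_spinPolarized_of_ne h0 h1]
    exact memH1_zero
  · filter_upwards [a₁ σ, a₂ σ] with x hx₁ hx₂
    have e : ∀ c : ZMod 2, (∀ i, s (σ i) = c) ↔ ∀ i, s i = c := fun c =>
      σ.forall_congr_left.trans (by simp)
    simp only [spinPolarized, e]
    split_ifs
    · exact hx₁
    · exact hx₂
    · simp
  · rw [sum_spinComponent_spinPolarized (fun Φ => ∫⁻ x, ‖Φ x‖ₑ ^ 2) (by simp)]
    have hN : ((n + 1 : ℕ) : ℝ≥0∞) ≠ 0 := by simp
    have hN' : ((n + 1 : ℕ) : ℝ≥0∞) ≠ ⊤ := by finiteness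
    have h3 := lintegral_congr_ae hd
    rw [lintegral_add_left' (aemeasurable_oneBodyDensity h₁.1.1), lintegral_oneBodyDensity h₁.1.1,
      lintegral_oneBodyDensity h₂.1.1, hρ.lintegral_eq, ← mul_add] at h3
    exact (ENNReal.mul_right_inj hN hN').mp (h3.trans (mul_one _).symm)
  · filter_upwards [hd] with x hx
    rw [sum_spinComponent_spinPolarized (fun Φ => oneBodyDensity Φ x) (by simp [oneBodyDensity]),
      hx]

theorem sum_interactionEnergy_spinPolarized :
    ∑ s : Fin (n + 1) → ZMod 2, interactionEnergy (spinComponent (spinPolarized Φ₁ Φ₂) s)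
      = interactionEnergy Φ₁ + interactionEnergy Φ₂ :=
  sum_spinComponent_spinPolarized _ (by simp [interactionEnergy])

end SpinPolarized

/-! ### Antisymmetric cutoffs in the first coordinate. -/

section Cutoff

/-- The odd function `t ↦ m t`, truncated to `[-1, 1]`. -/
def clampMul (m : ℕ) (t : ℝ) : ℝ := max (-1) (min 1 (m * t))

theorem clampMul_neg (m : ℕ) (t : ℝ) : clampMul m (-t) = -clampMul m t := by
  simp only [clampMul, mul_neg, max_def, min_def]
  split_ifs <;> linarith

theorem abs_clampMul_le (m : ℕ) (t : ℝ) : |clampMul m t| ≤ 1 :=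
  abs_le.mpr ⟨le_max_left _ _, max_le (by norm_num) (min_le_left _ _)⟩

theorem lipschitzWith_clampMul (m : ℕ) : LipschitzWith m (clampMul m) := by
  have h : LipschitzWith m fun t : ℝ => (m : ℝ) * t := by
    refine LipschitzWith.of_dist_le_mul fun x y => ?_
    rw [Real.dist_eq, Real.dist_eq, ← mul_sub, abs_mul]
    simp
  exact (h.const_min 1).const_max (-1)

theorem eventually_abs_clampMul_eq_one {t : ℝ} (ht : t ≠ 0) :
    ∀ᶠ m : ℕ in atTop, |clampMul m t| = 1 := by
  obtain ⟨m₀, hm₀⟩ := exists_nat_ge |t|⁻¹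
  have hpos : 0 < |t| := abs_pos.mpr ht
  filter_upwards [eventually_ge_atTop m₀] with m hm
  have h1 : 1 ≤ (m : ℝ) * |t| := by
    have : |t|⁻¹ ≤ m := hm₀.trans (by exact_mod_cast hm)
    calc (1 : ℝ) = |t|⁻¹ * |t| := (inv_mul_cancel₀ hpos.ne').symm
      _ ≤ _ := by gcongr
  rcases lt_or_gt_of_ne ht with h | h
  · rw [abs_of_neg h] at h1
    rw [clampMul, min_eq_right (by linarith), max_eq_left (by linarith)]
    simp
  · rw [abs_of_pos h] at h1
    rw [clampMul, min_eq_left h1, max_eq_right (by norm_num)]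
    simp

/-- A Lipschitz antisymmetric function of the first coordinates of the particles, with values in
`[-1, 1]`, that tends to `±1` as `m → ∞`. -/
def signCutoff (m : ℕ) {N : ℕ} (x : Config N) : ℝ :=
  oddProd (clampMul m) fun i => x i 0

variable {N : ℕ}

theorem exists_lipschitzWith_signCutoff (m : ℕ) :
    ∃ K, LipschitzWith K (signCutoff m : Config N → ℝ) :=
  exists_lipschitzWith_oddProd (h := clampMul m) (G := fun x : Space => x 0)
    (lipschitzWith_clampMul m) (abs_clampMul_le m) (lipschitzWith_coord 0)

theorem signCutoff_perm (m : ℕ) (σ : Equiv.Perm (Fin N)) (x : Config N) :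
    signCutoff m (fun i => x (σ i)) = (Equiv.Perm.sign σ : ℤ) * signCutoff m x :=
  oddProd_perm (clampMul_neg m) σ fun i => x i 0

/-- The coincidence set is the kernel of a nonzero linear functional, hence null. -/
theorem ae_coord_ne {i j : Fin N} (hij : i ≠ j) : ∀ᵐ x : Config N, x i 0 ≠ x j 0 := by
  let f : Config N →ₗ[ℝ] ℝ :=
    { toFun := fun x => x i 0 - x j 0
      map_add' := fun x y => by simp; ring
      map_smul' := fun c x => by simp; ring }
  have hf : LinearMap.ker f ≠ ⊤ := by
    intro h
    have h1 : (Pi.single i (EuclideanSpace.single 0 1) : Config N) ∈ LinearMap.ker f := by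
      rw [h]; trivial
    have h2 : f (Pi.single i (EuclideanSpace.single 0 1)) = 1 := by
      simp [f, hij.symm]
    rw [LinearMap.mem_ker, h2] at h1
    exact one_ne_zero h1
  have h0 := Measure.addHaar_submodule (volume : Measure (Config N)) (LinearMap.ker f) hf
  filter_upwards [measure_eq_zero_iff_ae_notMem.mp h0] with x hx h
  refine hx ?_
  simp [f, h]

theorem ae_eventually_abs_signCutoff :
    ∀ᵐ x : Config N, ∀ᶠ m in atTop, |signCutoff m x| = 1 := by
  have h : ∀ᵐ x : Config N, ∀ i j : Fin N, i ≠ j → x i 0 ≠ x j 0 := by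
    rw [ae_all_iff]; intro i
    rw [ae_all_iff]; intro j
    by_cases hij : i = j
    · exact .of_forall fun x h => absurd hij h
    · filter_upwards [ae_coord_ne hij] with x hx _ using hx
  filter_upwards [h] with x hx
  have h1 : ∀ᶠ m : ℕ in atTop, ∀ i j : Fin N, i ≠ j → |clampMul m (x j 0 - x i 0)| = 1 := by
    rw [eventually_all]; intro i
    rw [eventually_all]; intro j
    by_cases hij : i = j
    · exact .of_forall fun x h => absurd hij h
    · filter_upwards [eventually_abs_clampMul_eq_one (sub_ne_zero.mpr (hx j i (Ne.symm hij)))]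
        with m hm _ using hm
  filter_upwards [h1] with m hm
  rw [signCutoff, oddProd, Finset.abs_prod]
  refine Finset.prod_eq_one fun i _ => ?_
  rw [Finset.abs_prod]
  exact Finset.prod_eq_one fun j hj => hm i j (Finset.mem_Ioi.mp hj).ne

/-- The antisymmetric part `sin (π P / 2)` of the cutoff. -/
def oddCutoff (m : ℕ) (x : Config N) : ℝ := Real.sin (Real.pi / 2 * signCutoff m x)

/-- The complementary part `cos (π P / 2)` of the cutoff. -/
def evenCutoff (m : ℕ) (x : Config N) : ℝ := Real.cos (Real.pi / 2 * signCutoff m x)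

theorem exists_lipschitzWith_oddCutoff (m : ℕ) :
    ∃ K, LipschitzWith K (oddCutoff m : Config N → ℝ) := by
  obtain ⟨K, hK⟩ := exists_lipschitzWith_signCutoff (N := N) m
  exact ⟨_, Real.lipschitzWith_sin.comp ((lipschitzWith_smul (Real.pi / 2)).comp hK)⟩

theorem exists_lipschitzWith_evenCutoff (m : ℕ) :
    ∃ K, LipschitzWith K (evenCutoff m : Config N → ℝ) := by
  obtain ⟨K, hK⟩ := exists_lipschitzWith_signCutoff (N := N) m
  exact ⟨_, Real.lipschitzWith_cos.comp ((lipschitzWith_smul (Real.pi / 2)).comp hK)⟩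

theorem abs_oddCutoff_le (m : ℕ) (x : Config N) : |oddCutoff m x| ≤ 1 := Real.abs_sin_le_one _

theorem abs_evenCutoff_le (m : ℕ) (x : Config N) : |evenCutoff m x| ≤ 1 := Real.abs_cos_le_one _

theorem oddCutoff_perm (m : ℕ) (σ : Equiv.Perm (Fin N)) (x : Config N) :
    oddCutoff m (fun i => x (σ i)) = (Equiv.Perm.sign σ : ℤ) * oddCutoff m x := by
  rw [oddCutoff, signCutoff_perm, oddCutoff]
  rcases Int.units_eq_one_or (Equiv.Perm.sign σ) with h | h <;> simp [h]

/-- The cutoff depends only on coordinate `0` of each particle. Along coordinate `1` it is constant,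
so derivative bounds there are independent of `m`. -/
theorem evenCutoff_add_smul (m : ℕ) (x : Config (N + 1)) (t : ℝ) :
    evenCutoff m (x + t • (Pi.single 0 (EuclideanSpace.single 1 1) : Config (N + 1)))
      = evenCutoff m x := by
  rw [evenCutoff, evenCutoff, signCutoff, signCutoff]
  congr 3
  ext i
  refine Fin.cases ?_ (fun j => ?_) i <;> simp

theorem ae_eventually_evenCutoff_eq_zero :
    ∀ᵐ x : Config N, ∀ᶠ m in atTop, evenCutoff m x = 0 := by
  filter_upwards [ae_eventually_abs_signCutoff (N := N)] with x hx
  filter_upwards [hx] with m hm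
  rw [evenCutoff, ← Real.cos_abs, abs_mul, hm, abs_of_pos (by positivity), mul_one,
    Real.cos_pi_div_two]

theorem tendsto_eLpNorm_evenCutoff {Φ : Config N → ℂ} (hΦ : MemLp Φ 2 volume) :
    Tendsto (fun m : ℕ => eLpNorm (fun x => evenCutoff m x • Φ x) 2 volume ^ 2) atTop (𝓝 0) := by
  simp only [eLpNorm_two_sq]
  have hlim : Tendsto (fun m : ℕ => ∫⁻ x, ‖evenCutoff m x • Φ x‖ₑ ^ 2) atTop
      (𝓝 (∫⁻ _ : Config N, 0)) := by
    refine tendsto_lintegral_of_dominated_convergence' (fun x => ‖Φ x‖ₑ ^ 2) (fun m => ?_)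
      (fun m => .of_forall fun x => ?_) ?_ ?_
    · obtain ⟨K, hK⟩ := exists_lipschitzWith_evenCutoff (N := N) m
      exact (hK.continuous.aestronglyMeasurable.smul hΦ.1).enorm.pow_const 2
    · dsimp only
      gcongr
      rw [enorm_le_iff_norm_le, norm_smul]
      exact mul_le_of_le_one_left (norm_nonneg _) (abs_evenCutoff_le m x)
    · rw [← eLpNorm_two_sq]
      exact ENNReal.pow_ne_top hΦ.2.ne
    · filter_upwards [ae_eventually_evenCutoff_eq_zero (N := N)] with x hx
      refine tendsto_const_nhds.congr' ?_
      filter_upwards [hx] with m hm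
      simp [hm]
  simpa using hlim

theorem enorm_sq_cutoff (m : ℕ) (Φ : Config N → ℂ) (x : Config N) :
    ‖Φ x‖ₑ ^ 2 = ‖oddCutoff m x • Φ x‖ₑ ^ 2 + ‖evenCutoff m x • Φ x‖ₑ ^ 2 := by
  rw [enorm_smul, enorm_smul, mul_pow, mul_pow, ← add_mul,
    ← enorm_pow (oddCutoff m x), ← enorm_pow (evenCutoff m x),
    Real.enorm_eq_ofReal (sq_nonneg _), Real.enorm_eq_ofReal (sq_nonneg _),
    ← ENNReal.ofReal_add (sq_nonneg _) (sq_nonneg _), oddCutoff, evenCutoff, Real.sin_sq_add_cos_sq,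
    ENNReal.ofReal_one, one_mul]

end Cutoff

/-! ### Equality of the two interaction infima. -/

section Comparison

variable {n : ℕ} {ρ : Space → ℝ}

/-- Gives finiteness of the limit, by using the filler for `√ρ` itself in one polarization and zero
in the other. -/
theorem exists_fermionic_of_density (hρ : IsDensity (n + 1) ρ) :
    ∃ Ψ : (Fin (n + 1) → Space × ZMod 2) → ℂ, IsFermionic Ψ ∧ FermionicRepresents Ψ ρ ∧
      ∑ s : Fin (n + 1) → ZMod 2, interactionEnergy (spinComponent Ψ s) ≠ ⊤ := by
  have hw := memH1_iff.mp hρ.sqrt_memH1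
  obtain ⟨C, hC⟩ := hw.2 (EuclideanSpace.single 1 1)
  obtain ⟨Φ, h1, h2, h3, h4⟩ := exists_antisymm_of_sqrtDensity n hw.1 hw.2 hC
  obtain ⟨f1, f2⟩ := isFermionic_spinPolarized (Φ₁ := fun _ => 0) (Φ₂ := Φ) hρ memH1_zero h1
    (fun σ => by simp) (fun σ => .of_forall (h2 σ)) (by
      filter_upwards [h3, hρ.nonneg] with x hx hx0
      rw [hx, Real.sq_sqrt hx0]
      simp [oneBodyDensity])
  refine ⟨_, f1, f2, ?_⟩
  rw [sum_interactionEnergy_spinPolarized]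
  refine ENNReal.add_ne_top.mpr ⟨by simp [interactionEnergy], ne_top_of_le_ne_top ?_ h4⟩
  exact ENNReal.mul_ne_top (fillerConst_ne_top n)
    (ENNReal.mul_ne_top ENNReal.coe_ne_top hw.1.2.ne)

theorem interactionEnergy_smul_le {N : ℕ} {g : Config N → ℝ} (hg : ∀ x, |g x| ≤ 1)
    (Φ : Config N → ℂ) : interactionEnergy (fun x => g x • Φ x) ≤ interactionEnergy Φ := by
  refine lintegral_mono fun x => ?_
  dsimp only
  gcongr
  rw [enorm_le_iff_norm_le, norm_smul]
  exact mul_le_of_le_one_left (norm_nonneg _) (hg x)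

/-- A bosonic wavefunction is approximated in interaction energy by fermionic wavefunctions of the
same density: away from coincidences of first coordinates one multiplies by a sign, and the small
remainder is replaced by an antisymmetric function with the opposite spin polarization. -/
theorem exists_fermionic_of_bosonic (hρ : IsDensity (n + 1) ρ) {Φ : Config (n + 1) → ℂ}
    (hΦ : IsBosonic Φ) (hr : BosonicRepresents Φ ρ) {b : ℝ≥0∞} (hb : interactionEnergy Φ < b) :
    ∃ Ψ : (Fin (n + 1) → Space × ZMod 2) → ℂ, IsFermionic Ψ ∧ FermionicRepresents Ψ ρ ∧
      ∑ s : Fin (n + 1) → ZMod 2, interactionEnergy (spinComponent Ψ s) < b := by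
  have hΦL := hΦ.memH1.1
  obtain ⟨C, hC⟩ := (memH1_iff.mp hΦ.memH1).2
    (Pi.single 0 (EuclideanSpace.single 1 1) : Config (n + 1))
  set C' : ℝ≥0 := NNReal.sqrt (n + 1) * C with hC'
  let B : ℕ → Config (n + 1) → ℂ := fun m x => evenCutoff m x • Φ x
  have hBH : ∀ m, MemH1 (B m) := fun m => by
    obtain ⟨K, hK⟩ := exists_lipschitzWith_evenCutoff (N := n + 1) m
    exact hΦ.memH1.lipschitz_smul hK (abs_evenCutoff_le m)
  -- The constant `C` is that of `Φ`, uniformly in `m`: the Lipschitz constant of the cutoff in this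
  -- direction is `0`.
  have hBC : ∀ m, HasDiffBound (B m) (Pi.single 0 (EuclideanSpace.single 1 1)) C := fun m => by
    obtain ⟨K, hK⟩ := exists_lipschitzWith_evenCutoff (N := n + 1) m
    have := hC.lipschitz_smul (K := 0) hΦL hK.continuous.aestronglyMeasurable
      (abs_evenCutoff_le m) fun x t => by rw [evenCutoff_add_smul]; simp
    simpa [B] using this
  let w : ℕ → Space → ℝ := fun m => sqrtDensity (B m)
  have hwlim : Tendsto (fun m => eLpNorm (w m) 2 volume) atTop (𝓝 0) := by
    have h1 : Tendsto (fun m => eLpNorm (w m) 2 volume ^ 2) atTop (𝓝 0) := by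
      simp only [w, eLpNorm_sqrtDensity_sq (hBH _).1]
      have := ENNReal.Tendsto.const_mul (tendsto_eLpNorm_evenCutoff hΦL)
        (Or.inr (show ((n + 1 : ℕ) : ℝ≥0∞) ≠ ⊤ by finiteness))
      simpa [B] using this
    have h2 := (ENNReal.continuous_rpow_const (y := (1 / 2 : ℝ))).tendsto (0 : ℝ≥0∞) |>.comp h1
    rw [ENNReal.zero_rpow_of_pos (by norm_num)] at h2
    refine h2.congr fun m => ?_
    simp only [Function.comp]
    rw [← ENNReal.rpow_natCast, ← ENNReal.rpow_mul]
    norm_num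
  have hElim : Tendsto (fun m => interactionEnergy Φ
      + fillerConst n * (C' * eLpNorm (w m) 2 volume)) atTop (𝓝 (interactionEnergy Φ)) := by
    have h1 := ENNReal.Tendsto.const_mul (ENNReal.Tendsto.const_mul hwlim
      (Or.inr (ENNReal.coe_ne_top (r := C')))) (Or.inr (fillerConst_ne_top n))
    simpa using tendsto_const_nhds.add h1
  obtain ⟨m, hm⟩ := (hElim.eventually_lt_const hb).exists
  obtain ⟨K, hK⟩ := exists_lipschitzWith_oddCutoff (N := n + 1) m
  have hwH : ∀ e, ∃ C, HasDiffBound (w m) e C := fun e => by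
    obtain ⟨C₁, hC₁⟩ := (memH1_iff.mp (hBH m)).2 (Pi.single 0 e : Config (n + 1))
    exact ⟨_, hC₁.sqrtDensity (hBH m).1⟩
  obtain ⟨Φ₂, h1, h2, h3, h4⟩ := exists_antisymm_of_sqrtDensity n (memLp_sqrtDensity (hBH m).1) hwH
    ((hBC m).sqrtDensity (hBH m).1)
  have hA := hΦ.memH1.lipschitz_smul hK (abs_oddCutoff_le m)
  -- `Φ₂` has the density of the discarded cosine part, so `sin² + cos² = 1` restores `ρ`.
  obtain ⟨f1, f2⟩ := isFermionic_spinPolarized (Φ₁ := fun x => oddCutoff m x • Φ x) (Φ₂ := Φ₂) hρ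
    hA h1 (fun σ => by
      filter_upwards [hΦ.symm σ] with x hx
      rw [hx, oddCutoff_perm]
      simp only [Complex.real_smul]
      push_cast
      ring) (fun σ => .of_forall (h2 σ)) (by
      have hsum := oneBodyDensity_eq_sum (Φ := Φ)
        (u := fun b : Bool => if b then fun x => oddCutoff m x • Φ x else B m) (fun b => by
          cases b
          · exact (hBH m).1.1
          · exact hA.1.1) fun x => by simpa [B] using enorm_sq_cutoff m Φ x
      filter_upwards [h3, hsum, hr, ofReal_sqrtDensity_sq (hBH m).1] with x e1 e2 e3 e4
      rw [e1, e4, ← e3, e2]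
      simp)
  refine ⟨_, f1, f2, ?_⟩
  rw [sum_interactionEnergy_spinPolarized]
  exact (add_le_add (interactionEnergy_smul_le (abs_oddCutoff_le m) Φ) h4).trans_lt hm

theorem iInf_interactionEnergy_eq (hρ : IsDensity (n + 1) ρ) :
    (⨅ (Ψ : (Fin (n + 1) → Space × ZMod 2) → ℂ) (_ : IsFermionic Ψ) (_ : FermionicRepresents Ψ ρ),
      ∑ s : Fin (n + 1) → ZMod 2, interactionEnergy (spinComponent Ψ s))
    = ⨅ (Φ : Config (n + 1) → ℂ) (_ : IsBosonic Φ) (_ : BosonicRepresents Φ ρ),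
      interactionEnergy Φ := by
  apply le_antisymm
  · refine le_iInf fun Φ => le_iInf₂ fun hΦ hr => le_of_forall_gt fun b hb => ?_
    obtain ⟨Ψ, h1, h2, h3⟩ := exists_fermionic_of_bosonic hρ hΦ hr hb
    exact (iInf_le_of_le Ψ (iInf₂_le h1 h2)).trans_lt h3
  · refine le_iInf fun Ψ => le_iInf₂ fun hΨ hr => ?_
    obtain ⟨Φ, h1, h2, h3⟩ := exists_bosonic_of_fermionic hΨ hr
    rw [← h3]
    exact iInf_le_of_le Φ (iInf₂_le h1 h2)

end Comparison

end

theorem theorem3p2 (n : ℕ) (ρ : Space → ℝ) (hρ : IsDensity (n + 1) ρ) :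
    ∃ L : ℝ≥0,
      Tendsto (fun α : ℝ => FHK n α ρ) (𝓝[>] 0) (𝓝 (L : ℝ≥0∞)) ∧
      Tendsto (fun α : ℝ => FBos n α ρ) (𝓝[>] 0) (𝓝 (L : ℝ≥0∞)) := by
  obtain ⟨Ψ, h1, h2, h3⟩ := exists_fermionic_of_density hρ
  have hfin : (⨅ (Ψ : (Fin (n + 1) → Space × ZMod 2) → ℂ) (_ : IsFermionic Ψ)
      (_ : FermionicRepresents Ψ ρ),
      ∑ s : Fin (n + 1) → ZMod 2, interactionEnergy (spinComponent Ψ s)) ≠ ⊤ :=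
    ne_top_of_le_ne_top h3 (iInf_le_of_le Ψ (iInf₂_le h1 h2))
  obtain ⟨L, hL⟩ : ∃ L : ℝ≥0, (L : ℝ≥0∞) = _ := ⟨_, ENNReal.coe_toNNReal hfin⟩
  refine ⟨L, ?_, ?_⟩ <;> rw [hL]
  · exact tendsto_iInf_mul_add fun Ψ hΨ =>
      ENNReal.sum_ne_top.mpr fun s _ => kineticEnergy_ne_top (hΨ.memH1 s)
  · rw [iInf_interactionEnergy_eq hρ]
    exact tendsto_iInf_mul_add fun Φ hΦ => kineticEnergy_ne_top hΦ.memH1
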